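/- **Setting.** In online facility assignment on a line, servers $s_1<\dots<s_m$ are points of $\mathbb R$ and server $s$ has a capacity $c(s)\in\{1,2,\dots\}$. Requests $\sigma=r_1\cdots r_n$ with $r_i\in\mathbb R$ and $n\le\sum_s c(s)$ arrive one by one. An online algorithm must irrevocably match each request, on arrival, with a free server, i.e. one that has so far received fewer than $c(s)$ requests. Matching $r$ with $s$ costs $|r-s|$. Let $\mathcal A(\sigma)$ be the total cost of the algorithm $\mathcal A$ and $\mathrm{Opt}(\sigma)$ the minimum cost of a matching of $\sigma$ that respects the capacities. $\mathcal A$ is $\rho$-competitive if $\mathcal A(\sigma)\le\rho\,\mathrm{Opt}(\sigma)$ for all such $\sigma$, and its competitive ratio is $\mathcal R(\mathcal A)=\inf\{\rho\ge 1:\mathcal A\text{ is }\rho\text{-competitive}\}$. **PTCP.** For a server set $S=\{s_1<\dots<s_m\}$ with $m\ge 2$, let $s_{a+1}-s_a=D$ be a maximum gap between adjacent servers, $S_1=\{s_1,\dots,s_a\}$, $S_2=\{s_{a+1},\dots,s_m\}$, $\Delta_1=s_a-s_1$, $\Delta_2=s_m-s_{a+1}$ and $x=\frac{\Delta_2+D}{(\Delta_1+D)+(\Delta_2+D)}D$.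 When $F\ne\emptyset$ is the set of free servers, PTCP matches a request $r$ with the server $\mathcal A^*[S](r,F)$, defined recursively: it is $s$ if $F=\{s\}$; otherwise it is $\mathcal A^*[S_1](r,F\cap S_1)$ if ($r\le s_a+x$ and $F\cap S_1\neq\emptyset$) or $F\cap S_2=\emptyset$; and it is $\mathcal A^*[S_2](r,F\cap S_2)$ in all other cases. **Permutation.** For every request sequence $\sigma$ as above fix an optimal matching $M_\sigma$ such that, whenever $\sigma$ is extended by one request $r$, the multiset of servers used by $M_{\sigma r}$ is that used by $M_\sigma$ plus one further server $s$ (such a choice is always possible). The Permutation algorithm, after having processed $\sigma$, matches $r$ with this $s$. If several choices of the $M_\sigma$ are possible, the theorem holds for each of them. **Theorem.** Let $k\ge1$ and $\varepsilon>0$. There exist $\delta\in(0,1)$ with $$\delta^k+\delta(4k-1)<\varepsilon\qquad\text{and}\qquad (1-\delta)^{-1}<1+\varepsilon/2 .$$ For every such $\delta$, let $S=\{s_1,\dots,s_{2k}\}$ be given by $$s_{k+i}=\frac{1-\delta^i}{1-\delta},\qquad s_{k-i+1}=-\frac{1-\delta^i}{1-\delta}\qquad(i=1,\dots,k).$$ Then,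 for every capacity $c:S\to\{1,2,\dots\}$, PTCP is $(3+\varepsilon)$-competitive, and the competitive ratio of the Permutation algorithm is at least $4k-1-\varepsilon$. -/

import Mathlib

open Finset

namespace OFAL

/-! Online facility assignment on the real line.  The servers are indexed by `Fin m`, server `s`
stands at the point `p s` and can serve at most `c s` requests.  A request is a point of the line,
a request sequence is a list (in order of arrival), and a matching is the list of the pairs
(request, server that serves it). -/

/-- A (partial) matching: the pairs (request, server), in the order of arrival. -/
abbrev Matching (m : ℕ) : Type := List (ℝ × Fin m)

/-- The number of requests that the matching `M` assigns to the server `s`. -/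
def load {m : ℕ} (M : Matching m) (s : Fin m) : ℕ := M.countP (fun e => decide (e.2 = s))

/-- The cost of a matching: the sum of the distances between requests and their servers. -/
noncomputable def cost {m : ℕ} (p : Fin m → ℝ) (M : Matching m) : ℝ :=
  (M.map (fun e => |e.1 - p e.2|)).sum

/-- The servers that are free (not full) in the matching `M`. -/
def free {m : ℕ} (c : Fin m → ℕ) (M : Matching m) : Finset (Fin m) :=
  univ.filter (fun s => load M s < c s)

/-- A request sequence is admissible if it is not longer than the total capacity. -/
def Admissible {m : ℕ} (c : Fin m → ℕ) (σ : List ℝ) : Prop := σ.length ≤ ∑ s, c s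

/-- `M` matches exactly the requests of `σ` and respects the capacities. -/
def IsMatching {m : ℕ} (c : Fin m → ℕ) (σ : List ℝ) (M : Matching m) : Prop :=
  M.map Prod.fst = σ ∧ ∀ s, load M s ≤ c s

/-- `M` is an optimal (minimum cost) matching of the requests of `σ`. -/
def IsOptimalMatching {m : ℕ} (p : Fin m → ℝ) (c : Fin m → ℕ) (σ : List ℝ) (M : Matching m) :
    Prop :=
  IsMatching c σ M ∧ ∀ M', IsMatching c σ M' → cost p M ≤ cost p M'

/-- The optimal offline cost of `σ`.  For an admissible `σ` this is the infimum of a finite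
non-empty set, that is, a minimum. -/
noncomputable def optCost {m : ℕ} (p : Fin m → ℝ) (c : Fin m → ℕ) (σ : List ℝ) : ℝ :=
  sInf (cost p '' {M | IsMatching c σ M})

/-- A deterministic online algorithm: given the current matching (which records all past requests
and how they were served) and the new request, it picks a free server, as long as there is one. -/
structure OnlineAlgorithm {m : ℕ} (c : Fin m → ℕ) where
  /-- The server chosen for the new request. -/
  pick : (M : Matching m) → ℝ → (free c M).Nonempty → Fin m
  /-- The chosen server is free. -/
  pick_mem : ∀ M r h, pick M r h ∈ free c M

/-- The matching after one more request.  (Without any free server nothing is done; this never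
happens on admissible sequences.) -/
def OnlineAlgorithm.step {m : ℕ} {c : Fin m → ℕ} (A : OnlineAlgorithm c) (M : Matching m) (r : ℝ) :
    Matching m :=
  if h : (free c M).Nonempty then M ++ [(r, A.pick M r h)] else M

/-- The matching that the online algorithm produces on the request sequence `σ`. -/
def OnlineAlgorithm.run {m : ℕ} {c : Fin m → ℕ} (A : OnlineAlgorithm c) (σ : List ℝ) : Matching m :=
  σ.foldl A.step []

/-- `A` is `ρ`-competitive (in the strict sense). -/
def IsCompetitive {m : ℕ} (p : Fin m → ℝ) {c : Fin m → ℕ} (A : OnlineAlgorithm c) (ρ : ℝ) : Prop :=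
  ∀ σ : List ℝ, Admissible c σ → cost p (A.run σ) ≤ ρ * optCost p c σ

/-- The competitive ratio of `A`: the infimum of the `ρ ≥ 1` such that `A` is `ρ`-competitive
(`⊤` if there is none). -/
noncomputable def competitiveRatio {m : ℕ} (p : Fin m → ℝ) {c : Fin m → ℕ} (A : OnlineAlgorithm c) :
    EReal :=
  sInf ((fun ρ : ℝ => (ρ : EReal)) '' {ρ : ℝ | 1 ≤ ρ ∧ IsCompetitive p A ρ})

/-! ### The algorithm PTCP -/

/-- The pairs of adjacent servers of the set `S`. -/
def adjacentPairs {m : ℕ} (S : Finset (Fin m)) : Finset (Fin m × Fin m) :=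
  (S ×ˢ S).filter (fun q => q.1 < q.2 ∧ ∀ t ∈ S, t ≤ q.1 ∨ q.2 ≤ t)

theorem adjacentPairs_nonempty {m : ℕ} {S : Finset (Fin m)} (h : 2 ≤ S.card) :
    (adjacentPairs S).Nonempty := by
  obtain ⟨a, ha, b, hb, hab⟩ := Finset.one_lt_card.1 h
  have hne : S.Nonempty := ⟨a, ha⟩
  have hT : (S.filter (fun t => S.min' hne < t)).Nonempty := by
    by_contra hcon
    rw [Finset.not_nonempty_iff_eq_empty, Finset.filter_eq_empty_iff] at hcon
    have h1 := le_antisymm (not_lt.1 (hcon ha)) (S.min'_le a ha)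
    have h2 := le_antisymm (not_lt.1 (hcon hb)) (S.min'_le b hb)
    exact hab (h1.trans h2.symm)
  have hm := Finset.mem_filter.1 (Finset.min'_mem _ hT)
  refine ⟨(S.min' hne, (S.filter (fun t => S.min' hne < t)).min' hT), ?_⟩
  simp only [adjacentPairs, Finset.mem_filter, Finset.mem_product]
  refine ⟨⟨S.min'_mem hne, hm.1⟩, hm.2, fun t ht => ?_⟩
  rcases lt_or_ge (S.min' hne) t with h | h
  · exact Or.inr (Finset.min'_le _ _ (Finset.mem_filter.2 ⟨ht, h⟩))
  · exact Or.inl h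

/-- A pair of adjacent servers of `S` at maximum distance (the choice among ties is arbitrary). -/
noncomputable def splitPair {m : ℕ} (p : Fin m → ℝ) (S : Finset (Fin m)) (h : 2 ≤ S.card) :
    Fin m × Fin m :=
  (Finset.exists_max_image (adjacentPairs S) (fun q => p q.2 - p q.1)
    (adjacentPairs_nonempty h)).choose

theorem splitPair_spec {m : ℕ} (p : Fin m → ℝ) (S : Finset (Fin m)) (h : 2 ≤ S.card) :
    splitPair p S h ∈ adjacentPairs S ∧ ∀ q ∈ adjacentPairs S,
      p q.2 - p q.1 ≤ p (splitPair p S h).2 - p (splitPair p S h).1 :=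
  (Finset.exists_max_image (adjacentPairs S) (fun q => p q.2 - p q.1)
    (adjacentPairs_nonempty h)).choose_spec

/-- The servers of `S` to the left of the maximum gap. -/
noncomputable def leftPart {m : ℕ} (p : Fin m → ℝ) (S : Finset (Fin m)) (h : 2 ≤ S.card) :
    Finset (Fin m) :=
  S.filter (fun t => t ≤ (splitPair p S h).1)

/-- The servers of `S` to the right of the maximum gap. -/
noncomputable def rightPart {m : ℕ} (p : Fin m → ℝ) (S : Finset (Fin m)) (h : 2 ≤ S.card) :
    Finset (Fin m) :=
  S.filter (fun t => (splitPair p S h).2 ≤ t)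

/-- The critical point `s_a + x` with `x = (Δ₂ + D) / ((Δ₁ + D) + (Δ₂ + D)) * D`, where `D` is the
maximum gap `s_{a+1} - s_a`, and `Δ₁`, `Δ₂` are the diameters of the left and the right part. -/
noncomputable def criticalPoint {m : ℕ} (p : Fin m → ℝ) (S : Finset (Fin m)) (h : 2 ≤ S.card) : ℝ :=
  let hne : S.Nonempty := Finset.card_pos.1 (lt_of_lt_of_le Nat.zero_lt_two h)
  let a := (splitPair p S h).1
  let b := (splitPair p S h).2
  let D := p b - p a
  let Δ₁ := p a - p (S.min' hne)
  let Δ₂ := p (S.max' hne) - p b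
  p a + (Δ₂ + D) / ((Δ₁ + D) + (Δ₂ + D)) * D

theorem leftPart_card_lt {m : ℕ} (p : Fin m → ℝ) (S : Finset (Fin m)) (h : 2 ≤ S.card) :
    (leftPart p S h).card < S.card := by
  have hs := (splitPair_spec p S h).1
  simp only [adjacentPairs, Finset.mem_filter, Finset.mem_product] at hs
  refine Finset.card_lt_card ((Finset.ssubset_iff_of_subset (Finset.filter_subset _ _)).2
    ⟨_, hs.1.2, fun hm => ?_⟩)
  exact absurd (Finset.mem_filter.1 hm).2 (not_le.2 hs.2.1)

theorem rightPart_card_lt {m : ℕ} (p : Fin m → ℝ) (S : Finset (Fin m)) (h : 2 ≤ S.card) :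
    (rightPart p S h).card < S.card := by
  have hs := (splitPair_spec p S h).1
  simp only [adjacentPairs, Finset.mem_filter, Finset.mem_product] at hs
  refine Finset.card_lt_card ((Finset.ssubset_iff_of_subset (Finset.filter_subset _ _)).2
    ⟨_, hs.1.1, fun hm => ?_⟩)
  exact absurd (Finset.mem_filter.1 hm).2 (not_le.2 hs.2.1)

theorem left_or_right {m : ℕ} (p : Fin m → ℝ) (S : Finset (Fin m)) (h : 2 ≤ S.card) {t : Fin m}
    (ht : t ∈ S) : t ∈ leftPart p S h ∨ t ∈ rightPart p S h := by
  have hs := (splitPair_spec p S h).1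
  simp only [adjacentPairs, Finset.mem_filter, Finset.mem_product] at hs
  rcases hs.2.2 t ht with h1 | h1
  · exact Or.inl (Finset.mem_filter.2 ⟨ht, h1⟩)
  · exact Or.inr (Finset.mem_filter.2 ⟨ht, h1⟩)

open Classical in
/-- The server with which PTCP for the server set `S` matches a request at `r`, when `F` is the
(non-empty) set of free servers of `S`. -/
noncomputable def ptcpServer {m : ℕ} (p : Fin m → ℝ) (r : ℝ) (S F : Finset (Fin m)) (hFS : F ⊆ S)
    (hF : F.Nonempty) : {s : Fin m // s ∈ F} :=
  if h1 : F.card = 1 then ⟨hF.choose, hF.choose_spec⟩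
  else
    have h2 : 2 ≤ S.card := by
      have h3 := Finset.card_le_card hFS
      have h4 := Finset.card_pos.2 hF
      omega
    if hL : (r ≤ criticalPoint p S h2 ∧ (F ∩ leftPart p S h2).Nonempty) ∨
        F ∩ rightPart p S h2 = ∅ then
      have hne : (F ∩ leftPart p S h2).Nonempty := by
        rcases hL with hL | hL
        · exact hL.2
        · obtain ⟨t, ht⟩ := hF
          rcases left_or_right p S h2 (hFS ht) with h5 | h5
          · exact ⟨t, Finset.mem_inter.2 ⟨ht, h5⟩⟩
          · exact absurd (Finset.mem_inter.2 ⟨ht, h5⟩) (by rw [hL]; exact Finset.notMem_empty t)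
      let s := ptcpServer p r (leftPart p S h2) (F ∩ leftPart p S h2) Finset.inter_subset_right hne
      ⟨s.1, (Finset.mem_inter.1 s.2).1⟩
    else
      have hne : (F ∩ rightPart p S h2).Nonempty :=
        Finset.nonempty_iff_ne_empty.2 (fun h6 => hL (Or.inr h6))
      let s := ptcpServer p r (rightPart p S h2) (F ∩ rightPart p S h2) Finset.inter_subset_right hne
      ⟨s.1, (Finset.mem_inter.1 s.2).1⟩
termination_by S.card
decreasing_by
  · exact leftPart_card_lt p S h2
  · exact rightPart_card_lt p S h2

/-- The online algorithm PTCP (Policy Transition at Critical Point). -/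
noncomputable def ptcp {m : ℕ} (p : Fin m → ℝ) (c : Fin m → ℕ) : OnlineAlgorithm c where
  pick M r h := (ptcpServer p r univ (free c M) (Finset.subset_univ _) h).1
  pick_mem M r h := (ptcpServer p r univ (free c M) (Finset.subset_univ _) h).2

/-! ### The Permutation algorithm -/

/-- `A` is the Permutation algorithm (with some way of choosing among several optimal matchings):
there are optimal matchings `Opt σ` of all admissible sequences `σ` such that, when a request `r`
arrives after `σ`, the servers used by `Opt (σ r)`, counted with multiplicity, are those used by
`Opt σ` together with one further server `s`, and `A` matches `r` with this server `s`. -/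
def IsPermutationAlgorithm {m : ℕ} (p : Fin m → ℝ) {c : Fin m → ℕ} (A : OnlineAlgorithm c) : Prop :=
  ∃ Opt : List ℝ → Matching m,
    (∀ σ, Admissible c σ → IsOptimalMatching p c σ (Opt σ)) ∧
    ∀ (σ : List ℝ) (r : ℝ), Admissible c (σ ++ [r]) →
      ∃ s : Fin m, (∀ t, load (Opt (σ ++ [r])) t = load (Opt σ) t + if t = s then 1 else 0) ∧
        A.run (σ ++ [r]) = A.run σ ++ [(r, s)]

/-! ### Permutation algorithms exist -/

theorem load_append {m : ℕ} (M N : Matching m) (s : Fin m) :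
    load (M ++ N) s = load M s + load N s := by
  simp [load]

theorem load_cons {m : ℕ} (e : ℝ × Fin m) (M : Matching m) (s : Fin m) :
    load (e :: M) s = load M s + if s = e.2 then 1 else 0 := by
  simp [load, List.countP_cons, eq_comm]

theorem load_nil {m : ℕ} (s : Fin m) : load ([] : Matching m) s = 0 := rfl

theorem sum_load {m : ℕ} (M : Matching m) : ∑ s, load M s = M.length := by
  induction M with
  | nil => simp [load_nil]
  | cons e M ih => simp [load_cons, Finset.sum_add_distrib, ih]

theorem cost_append {m : ℕ} (p : Fin m → ℝ) (M N : Matching m) :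
    cost p (M ++ N) = cost p M + cost p N := by
  simp [cost]

theorem cost_cons {m : ℕ} (p : Fin m → ℝ) (e : ℝ × Fin m) (M : Matching m) :
    cost p (e :: M) = |e.1 - p e.2| + cost p M := by
  simp [cost]

/-- Two matchings of the same requests, exchanged along an alternating path that starts at `s`. -/
theorem exists_exchange {m : ℕ} (p : Fin m → ℝ) (n : ℕ) : ∀ (L : List (ℝ × Fin m × Fin m)),
    L.length = n → ∀ s,
    load (L.map (fun e => (e.1, e.2.2))) s < load (L.map (fun e => (e.1, e.2.1))) s →
    ∃ (L' : List (ℝ × Fin m × Fin m)) (t : Fin m), L'.map Prod.fst = L.map Prod.fst ∧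
      cost p (L'.map (fun e => (e.1, e.2.1))) + cost p (L'.map (fun e => (e.1, e.2.2))) =
        cost p (L.map (fun e => (e.1, e.2.1))) + cost p (L.map (fun e => (e.1, e.2.2))) ∧
      load (L.map (fun e => (e.1, e.2.1))) t < load (L.map (fun e => (e.1, e.2.2))) t ∧
      (∀ u, load (L'.map (fun e => (e.1, e.2.1))) u + (if u = s then 1 else 0) =
        load (L.map (fun e => (e.1, e.2.1))) u + if u = t then 1 else 0) ∧
      (∀ u, load (L'.map (fun e => (e.1, e.2.2))) u + (if u = t then 1 else 0) =
        load (L.map (fun e => (e.1, e.2.2))) u + if u = s then 1 else 0) := by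
  induction n with
  | zero =>
    intro L hL s h
    rw [List.length_eq_zero_iff] at hL
    subst hL
    simp [load_nil] at h
  | succ n ih =>
    intro L hL s h
    have hex : ∃ e ∈ L, e.2.1 = s ∧ e.2.2 ≠ s := by
      by_contra! hcon
      apply absurd h
      rw [not_lt]
      simp only [load, List.countP_map]
      refine List.countP_mono_left fun e he h1 => ?_
      simp only [Function.comp_apply, decide_eq_true_eq] at h1 ⊢
      exact hcon e he h1
    obtain ⟨⟨r, a, b⟩, he, ha, hb⟩ := hex
    simp only at ha hb
    subst ha
    obtain ⟨L₁, L₂, rfl⟩ := List.append_of_mem he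
    by_cases hs : load ((L₁ ++ (r, a, b) :: L₂).map (fun e => (e.1, e.2.1))) b <
        load ((L₁ ++ (r, a, b) :: L₂).map (fun e => (e.1, e.2.2))) b
    · refine ⟨L₁ ++ (r, b, a) :: L₂, b, by simp, ?_, hs, ?_, ?_⟩
      · simp only [List.map_append, List.map_cons, cost_append, cost_cons]; ring
      · intro u
        simp only [List.map_append, List.map_cons, load_append, load_cons]; ring
      · intro u
        simp only [List.map_append, List.map_cons, load_append, load_cons]; ring
    · have hlen : (L₁ ++ L₂).length = n := by simp at hL ⊢; omega
      simp only [List.map_append, List.map_cons, load_append, load_cons] at hs h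
      obtain ⟨L', t, h1, h2, h3, h4, h5⟩ := ih (L₁ ++ L₂) hlen b (by
        simp only [List.map_append, load_append]
        simp [hb] at hs
        omega)
      rw [List.map_append, List.map_eq_append_iff] at h1
      obtain ⟨L₁', L₂', rfl, h6, h7⟩ := h1
      simp only [List.map_append, load_append, cost_append] at h2 h3 h4 h5
      refine ⟨L₁' ++ (r, b, a) :: L₂', t, by simp [h6, h7], ?_, ?_, ?_, ?_⟩
      · simp only [List.map_append, List.map_cons, cost_append, cost_cons]; linarith
      · simp only [List.map_append, List.map_cons, load_append, load_cons]
        by_cases hta : t = a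
        · subst hta
          simp [Ne.symm hb] at h
          omega
        · simp only [hta, if_false]; omega
      · intro u
        have := h4 u
        simp only [List.map_append, List.map_cons, load_append, load_cons]; omega
      · intro u
        have := h5 u
        simp only [List.map_append, List.map_cons, load_append, load_cons]; omega

theorem exists_zip {m : ℕ} (M : Matching m) : ∀ N : Matching m, M.map Prod.fst = N.map Prod.fst →
    ∃ L : List (ℝ × Fin m × Fin m), L.map Prod.fst = M.map Prod.fst ∧
      L.map (fun e => (e.1, e.2.1)) = M ∧ L.map (fun e => (e.1, e.2.2)) = N := by
  induction M with
  | nil =>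
    intro N h
    have h0 : N = [] := by simpa using h.symm
    exact ⟨[], by simp [h0]⟩
  | cons e M ih =>
    intro N h
    cases N with
    | nil => simp at h
    | cons e' N =>
      simp only [List.map_cons, List.cons.injEq] at h
      obtain ⟨L, h1, h2, h3⟩ := ih N h.2
      refine ⟨(e.1, e.2, e'.2) :: L, by simp [h1], by simp [h2], ?_⟩
      simp [h3, h.1]

theorem exists_isOptimalMatching {m : ℕ} (p : Fin m → ℝ) (c : Fin m → ℕ) (σ : List ℝ)
    (h : ∃ M, IsMatching c σ M) : ∃ M, IsOptimalMatching p c σ M := by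
  have hfin : {M : Matching m | IsMatching c σ M}.Finite := by
    refine ((List.finite_length_eq (Fin m) σ.length).image (fun l => σ.zip l)).subset ?_
    rintro M ⟨h1, -⟩
    refine ⟨M.map Prod.snd, by simp [← h1], ?_⟩
    subst h1
    exact (List.zip_of_prod rfl rfl).symm
  obtain ⟨M, hM, hmin⟩ := Set.exists_min_image _ (cost p) hfin h
  exact ⟨M, hM, hmin⟩

theorem exists_extension {m : ℕ} (p : Fin m → ℝ) (c : Fin m → ℕ) (σ : List ℝ) (r : ℝ)
    (hσ : Admissible c (σ ++ [r])) (M : Matching m) (hM : IsOptimalMatching p c σ M) :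
    ∃ (M' : Matching m) (s : Fin m), IsOptimalMatching p c (σ ++ [r]) M' ∧
      ∀ t, load M' t = load M t + if t = s then 1 else 0 := by
  have key : ∀ (d : ℕ) (G : Matching m), IsOptimalMatching p c (σ ++ [r]) G →
      ∑ s, (load M s - load G s) = d → ∃ M', IsOptimalMatching p c (σ ++ [r]) M' ∧
        ∀ t, load M t ≤ load M' t := by
    intro d
    induction d using Nat.strong_induction_on with
    | _ d ih =>
    intro G hG hd
    by_cases hall : ∀ t, load M t ≤ load G t
    · exact ⟨G, hG, hall⟩
    push Not at hall
    obtain ⟨s, hs⟩ := hall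
    have hG1 := hG.1.1
    rw [List.map_eq_append_iff] at hG1
    obtain ⟨G₀, G₁, rfl, hG0, hG1⟩ := hG1
    obtain ⟨L, hL0, hL1, hL2⟩ := exists_zip M G₀ (hM.1.1.trans hG0.symm)
    have hcost := hM.2
    simp only [load_append] at hs
    obtain ⟨L', t, h1, h2, h3, h4, h5⟩ := exists_exchange p L.length L rfl s (by
      rw [hL1, hL2]; omega)
    rw [hL1, hL2] at h2 h3
    rw [hL1] at h4
    rw [hL2] at h5
    have hst : t ≠ s := by rintro rfl; omega
    have hM1 : IsMatching c σ (L'.map (fun e => (e.1, e.2.1))) := by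
      refine ⟨?_, fun u => ?_⟩
      · rw [← hM.1.1, ← hL0, ← h1]; simp
      · have ha := h4 u
        have hb := hM.1.2 u
        have hc := hG.1.2 t
        rw [load_append] at hc
        by_cases hu : u = t
        · subst hu; simp [hst] at ha; omega
        · simp [hu] at ha; omega
    have hN1 : IsMatching c (σ ++ [r]) (L'.map (fun e => (e.1, e.2.2)) ++ G₁) := by
      refine ⟨?_, fun u => ?_⟩
      · rw [List.map_append, hG1, ← hM.1.1, ← hL0, ← h1]; simp
      · have ha := h5 u
        have hb := hG.1.2 u
        have hc := hM.1.2 s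
        rw [load_append] at hb ⊢
        by_cases hu : u = s
        · subst hu; simp [Ne.symm hst] at ha; omega
        · simp [hu] at ha; omega
    have hc1 := hM.2 _ hM1
    have hopt : IsOptimalMatching p c (σ ++ [r]) (L'.map (fun e => (e.1, e.2.2)) ++ G₁) := by
      refine ⟨hN1, fun N hN => le_trans ?_ (hG.2 N hN)⟩
      rw [cost_append, cost_append]; linarith
    refine ih _ ?_ _ hopt rfl
    rw [← hd]
    refine Finset.sum_lt_sum (fun u _ => ?_) ⟨s, Finset.mem_univ _, ?_⟩
    · have ha := h5 u
      rw [load_append, load_append]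
      by_cases hu : u = t
      · subst hu; simp [hst] at ha; omega
      · simp [hu] at ha; omega
    · have ha := h5 s
      rw [load_append, load_append]
      simp [Ne.symm hst] at ha; omega
  have hlen : M.length = σ.length := by rw [← hM.1.1]; simp
  have hfeas : ∃ N, IsMatching c (σ ++ [r]) N := by
    have hlt : ∑ s, load M s < ∑ s, c s := by
      have := hσ
      simp only [Admissible, List.length_append, List.length_singleton] at this
      rw [sum_load]; omega
    obtain ⟨s, -, hs⟩ := Finset.exists_lt_of_sum_lt hlt
    refine ⟨M ++ [(r, s)], by simp [hM.1.1], fun t => ?_⟩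
    have := hM.1.2 t
    rw [load_append, load_cons, load_nil]
    by_cases ht : t = s
    · subst ht; simp; omega
    · simp [ht]; omega
  obtain ⟨G, hG⟩ := exists_isOptimalMatching p c _ hfeas
  obtain ⟨M', hM', hle⟩ := key _ G hG rfl
  have hlen' : M'.length = σ.length + 1 := by
    have := congrArg List.length hM'.1.1
    simpa using this
  have hlt : ∑ s, load M s < ∑ s, load M' s := by rw [sum_load, sum_load]; omega
  obtain ⟨s, -, hs⟩ := Finset.exists_lt_of_sum_lt hlt
  refine ⟨M', s, hM', fun t => ?_⟩
  have hle' : ∀ u ∈ univ, load M u + (if u = s then 1 else 0) ≤ load M' u := by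
    intro u _
    by_cases hu : u = s
    · subst hu; simp; omega
    · simpa [hu] using hle u
  have hsum : ∑ u, (load M u + if u = s then 1 else 0) = ∑ u, load M' u := by
    rw [Finset.sum_add_distrib, sum_load, sum_load]; simp; omega
  exact ((Finset.sum_eq_sum_iff_of_le hle').1 hsum t (Finset.mem_univ t)).symm

/-- Permutation algorithms exist for all positions and capacities of the servers. -/
theorem exists_isPermutationAlgorithm {m : ℕ} (p : Fin m → ℝ) (c : Fin m → ℕ) :
    ∃ A : OnlineAlgorithm c, IsPermutationAlgorithm p A := by
  classical
  let next : List ℝ × Matching m → ℝ → Matching m := fun q r =>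
    if h : ∃ (M' : Matching m) (s : Fin m), IsOptimalMatching p c (q.1 ++ [r]) M' ∧
      ∀ t, load M' t = load q.2 t + if t = s then 1 else 0 then h.choose else []
  let st : List ℝ → List ℝ × Matching m := fun σ =>
    σ.foldl (fun q r => (q.1 ++ [r], next q r)) ([], [])
  have st_snoc : ∀ σ r, st (σ ++ [r]) = ((st σ).1 ++ [r], next (st σ) r) := by
    intro σ r; simp [st]
  have st_fst : ∀ σ, (st σ).1 = σ := by
    intro σ
    induction σ using List.reverseRecOn with
    | nil => rfl
    | append_singleton σ r ih => rw [st_snoc, ih]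
  have adm : ∀ σ r, Admissible c (σ ++ [r]) → Admissible c σ := by
    intro σ r h
    simp only [Admissible, List.length_append, List.length_singleton] at h ⊢
    omega
  have hnext : ∀ σ r, Admissible c (σ ++ [r]) → IsOptimalMatching p c σ (st σ).2 →
      IsOptimalMatching p c (σ ++ [r]) (st (σ ++ [r])).2 ∧ ∃ s, ∀ t,
        load (st (σ ++ [r])).2 t = load (st σ).2 t + if t = s then 1 else 0 := by
    intro σ r h hopt
    have hex := exists_extension p c σ r h _ hopt
    rw [st_snoc]
    simp only [next, st_fst]
    rw [dif_pos hex]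
    obtain ⟨s, h1, h2⟩ := hex.choose_spec
    exact ⟨h1, s, h2⟩
  have hopt : ∀ σ, Admissible c σ → IsOptimalMatching p c σ (st σ).2 := by
    intro σ
    induction σ using List.reverseRecOn with
    | nil =>
      intro _
      refine ⟨⟨rfl, fun s => Nat.zero_le _⟩, fun M' hM' => ?_⟩
      have h0 : M' = [] := by simpa using hM'.1
      rw [h0]
      exact le_rfl
    | append_singleton σ r ih => exact fun h => (hnext σ r h (ih (adm σ r h))).1
  let good : Matching m → ℝ → Fin m → Prop := fun N r s => s ∈ free c N ∧
    ∀ t, load (st (N.map Prod.fst ++ [r])).2 t =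
      load (st (N.map Prod.fst)).2 t + if t = s then 1 else 0
  let A : OnlineAlgorithm c :=
    { pick := fun N r h => if hg : ∃ s, good N r s then hg.choose else h.choose
      pick_mem := by
        intro N r h
        split_ifs with hg
        · exact hg.choose_spec.1
        · exact h.choose_spec }
  have run_snoc : ∀ σ r, A.run (σ ++ [r]) = A.step (A.run σ) r := by
    intro σ r; simp [OnlineAlgorithm.run]
  have hstep : ∀ σ r, Admissible c (σ ++ [r]) → (A.run σ).map Prod.fst = σ →
      (∀ t, load (A.run σ) t = load (st σ).2 t) → ∃ s, (∀ t,
        load (st (σ ++ [r])).2 t = load (st σ).2 t + if t = s then 1 else 0) ∧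
        A.run (σ ++ [r]) = A.run σ ++ [(r, s)] := by
    intro σ r h hfst hload
    obtain ⟨hM', s, hs⟩ := hnext σ r h (hopt σ (adm σ r h))
    have hfree : s ∈ free c (A.run σ) := by
      have h1 := hM'.1.2 s
      rw [hs s, if_pos rfl] at h1
      simp only [free, Finset.mem_filter, Finset.mem_univ, true_and, hload s]
      omega
    have hg : ∃ s, good (A.run σ) r s := ⟨s, hfree, by rw [hfst]; exact hs⟩
    refine ⟨hg.choose, ?_, ?_⟩
    · have := hg.choose_spec.2
      rwa [hfst] at this
    · rw [run_snoc, OnlineAlgorithm.step, dif_pos ⟨s, hfree⟩]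
      simp only [A]
      rw [dif_pos hg]
  have hrun : ∀ σ, Admissible c σ → (A.run σ).map Prod.fst = σ ∧
      ∀ t, load (A.run σ) t = load (st σ).2 t := by
    intro σ
    induction σ using List.reverseRecOn with
    | nil => exact fun _ => ⟨rfl, fun t => rfl⟩
    | append_singleton σ r ih =>
      intro h
      obtain ⟨h1, h2⟩ := ih (adm σ r h)
      obtain ⟨s, h3, h4⟩ := hstep σ r h h1 h2
      refine ⟨by rw [h4]; simp [h1], fun t => ?_⟩
      rw [h4, h3, load_append, load_cons, load_nil, h2]
      simp
  refine ⟨A, fun σ => (st σ).2, hopt, fun σ r h => ?_⟩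
  obtain ⟨h1, h2⟩ := hrun σ (adm σ r h)
  exact hstep σ r h h1 h2

/-! ### The server layout -/

/-- The layout of `2k` servers: the servers `s_{k+i}` and `s_{k-i+1}`, for `i = 1, …, k`, stand at
`(1 - δ ^ i) / (1 - δ)` and at `-(1 - δ ^ i) / (1 - δ)`.  The server `s_j` has index `j - 1`. -/
noncomputable def layout (k : ℕ) (δ : ℝ) (j : Fin (2 * k)) : ℝ :=
  if (j : ℕ) < k then -((1 - δ ^ (k - (j : ℕ))) / (1 - δ))
  else (1 - δ ^ ((j : ℕ) + 1 - k)) / (1 - δ)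

end OFAL

namespace OFAL

/-! ### Preferences of PTCP -/

/-! PTCP. The gaps of the layout are 2 in the middle and then `δ, δ ^ 2, …` outwards on both sides,
so every split of the recursion cuts at the innermost gap. The recursion thus amounts to pairwise
preferences (`prefers_ptcpServer`): servers of opposite sides are separated at the origin, and two
servers of one side at a critical point that depends only on the inner one.

Given an optimal matching, move the requests, from the last to the first, to the positions of their
servers. When all are moved, every request sits at a server with room for it and PTCP pays nothing
(`PicksBy.cost_foldl_at_servers`). Moving one request from `r` to a server `o` leaves two runs whose
states differ in one free place, `a` against `b`, while all later requests are at servers.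
`PicksBy.cost_foldl_le` bounds the excess by `potential`, the length of a walk from `b` to `a`: the
discrepancy moves only when the runs choose differently, and the preferences allow a detour to the
far end of the side of `b` only before it turns inwards.

It remains to show that one move costs at most `K * |r - o|` (`TwoSided.potential_start`). Let `D`
be the gap behind a server and `L` the distance from it to the end of its side. The critical point
lies `D * L / (D + L)` behind the server, and with this value the two competing requirements, for
`r` before and after the critical point, both become `2 * L ≤ (K - 1) * D`. Since the gaps are
geometric, `L ≤ D / (1 - δ)`, and `K = 3 + ε` suffices.

Permutation. Requests at the servers, free of charge, leave one place everywhere. Then a request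
comes at `η`, slightly to the right of the origin, and each further request comes at the server just
used. The requests so far can be matched to the servers nearest to `η` at a cost equal to the
distance from `η` to the last of these, and a Lipschitz potential shows that using a farther server
instead is dearer (`IsPermutationAlgorithm.exists_chase`). So Permutation crosses the central gap
again and again and pays at least `4 * k - 1 - η`, whereas the optimum is at most `radius δ k + η`,
which is close to 1. -/

/-- One level of the recursion of PTCP. -/
theorem ptcpServer_cases {m : ℕ} (p : Fin m → ℝ) (r : ℝ) (S F : Finset (Fin m)) (hFS : F ⊆ S)
    (hF : F.Nonempty) : F.card = 1 ∨ ∃ h2 : 2 ≤ S.card,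
      ((r ≤ criticalPoint p S h2 ∨ F ∩ rightPart p S h2 = ∅) ∧
        ∃ hne : (F ∩ leftPart p S h2).Nonempty, (ptcpServer p r S F hFS hF).1 =
          (ptcpServer p r (leftPart p S h2) (F ∩ leftPart p S h2) inter_subset_right hne).1) ∨
      (((F ∩ leftPart p S h2).Nonempty → criticalPoint p S h2 < r) ∧
        ∃ hne : (F ∩ rightPart p S h2).Nonempty, (ptcpServer p r S F hFS hF).1 =
          (ptcpServer p r (rightPart p S h2) (F ∩ rightPart p S h2) inter_subset_right hne).1) := by
  classical
  by_cases h1 : F.card = 1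
  · exact Or.inl h1
  have h2 : 2 ≤ S.card := by
    have h3 := Finset.card_le_card hFS
    have h4 := Finset.card_pos.2 hF
    omega
  refine Or.inr ⟨h2, ?_⟩
  by_cases hL : (r ≤ criticalPoint p S h2 ∧ (F ∩ leftPart p S h2).Nonempty) ∨
        F ∩ rightPart p S h2 = ∅
  · left
    have hne : (F ∩ leftPart p S h2).Nonempty := by
      rcases hL with hL | hL
      · exact hL.2
      · obtain ⟨t, ht⟩ := hF
        rcases left_or_right p S h2 (hFS ht) with h5 | h5
        · exact ⟨t, Finset.mem_inter.2 ⟨ht, h5⟩⟩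
        · exact absurd (Finset.mem_inter.2 ⟨ht, h5⟩) (by rw [hL]; exact Finset.notMem_empty t)
    refine ⟨hL.imp And.left id, hne, ?_⟩
    rw [ptcpServer, dif_neg h1, dif_pos (by convert hL)]
  · right
    push Not at hL
    refine ⟨fun h => not_le.1 fun h' => ?_, hL.2, ?_⟩
    · exact h.ne_empty (hL.1 h')
    rw [ptcpServer, dif_neg h1, dif_neg (by
      push Not
      exact hL)]

/-! ### The geometry of the layout: two symmetric sides with geometric gaps. -/

/-- The distance of the `e`-th server of either side from the origin. -/
noncomputable def radius (δ : ℝ) (e : ℕ) : ℝ := (1 - δ ^ e) / (1 - δ)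

/-- For `e ≥ 1` this is the gap behind the `e`-th server; that the gaps shrink outwards decides all
splits of PTCP. -/
theorem radius_succ {δ : ℝ} (h1 : δ < 1) (e : ℕ) : radius δ (e + 1) = radius δ e + δ ^ e := by
  have : 1 - δ ≠ 0 := by linarith
  unfold radius
  field_simp
  ring

theorem radius_one {δ : ℝ} (h1 : δ < 1) : radius δ 1 = 1 := by
  have : 1 - δ ≠ 0 := by linarith
  simp [radius, this]

theorem radius_strictMono {δ : ℝ} (h0 : 0 < δ) (h1 : δ < 1) : StrictMono (radius δ) :=
  strictMono_nat_of_lt_succ fun e => by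
    rw [radius_succ h1]
    linarith [pow_pos h0 e]

theorem one_le_radius {δ : ℝ} (h0 : 0 < δ) (h1 : δ < 1) {e : ℕ} (he : 1 ≤ e) :
    1 ≤ radius δ e := by
  rw [← radius_one h1]
  exact (radius_strictMono h0 h1).monotone he

/-- The gap behind the `e`-th server dominates the rest of the side. -/
theorem radius_sub_le {δ : ℝ} (h0 : 0 < δ) (h1 : δ < 1) (k e : ℕ) :
    radius δ k - radius δ e ≤ δ ^ e * (1 - δ)⁻¹ := by
  have : 0 < 1 - δ := by linarith
  have := pow_pos h0 k
  unfold radius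
  rw [← sub_div, ← div_eq_mul_inv]
  gcongr
  linarith

/-- The number of a server on its side, counted from the origin. -/
def rank (k : ℕ) (j : Fin (2 * k)) : ℕ := if (j : ℕ) < k then k - j else j + 1 - k

/-- The side of a server, `1` or `-1`. -/
noncomputable def side (k : ℕ) (j : Fin (2 * k)) : ℝ := if (j : ℕ) < k then -1 else 1

theorem layout_eq (k : ℕ) (δ : ℝ) (j : Fin (2 * k)) :
    layout k δ j = side k j * radius δ (rank k j) := by
  unfold layout side rank radius
  split_ifs <;> ring

/-- The distance from the origin of the critical point behind the `e`-th server of a side. -/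
noncomputable def critical (k : ℕ) (δ : ℝ) (e : ℕ) : ℝ :=
  radius δ e + δ ^ e * (radius δ k - radius δ e) / (δ ^ e + (radius δ k - radius δ e))

theorem layout_right {k : ℕ} {δ : ℝ} {j : Fin (2 * k)} (h : k ≤ j) :
    layout k δ j = radius δ (j + 1 - k) := by
  simp [layout, radius, not_lt.2 h]

theorem layout_left {k : ℕ} {δ : ℝ} {j : Fin (2 * k)} (h : j < k) :
    layout k δ j = -radius δ (k - j) := by
  simp [layout, radius, h]

theorem layout_strictMono {k : ℕ} {δ : ℝ} (h0 : 0 < δ) (h1 : δ < 1) :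
    StrictMono (layout k δ) := by
  intro i j hij
  have hm := radius_strictMono h0 h1
  have hij' : (i : ℕ) < j := hij
  rcases lt_or_ge (i : ℕ) k with hi | hi
  · rw [layout_left hi]
    rcases lt_or_ge (j : ℕ) k with hj | hj
    · rw [layout_left hj, neg_lt_neg_iff]
      exact hm (by omega)
    · rw [layout_right hj]
      have := one_le_radius h0 h1 (e := k - i) (by omega)
      have := one_le_radius h0 h1 (e := j + 1 - k) (by omega)
      linarith
  · rw [layout_right hi, layout_right (by omega)]
    exact hm (by omega)

/-- The critical point that decides between the servers `i < j`. -/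
noncomputable def threshold (k : ℕ) (δ : ℝ) (i j : Fin (2 * k)) : ℝ :=
  if (j : ℕ) < k then -critical k δ (rank k j)
  else if k ≤ (i : ℕ) then critical k δ (rank k i) else 0

/-- PTCP prefers the server `s` to the server `g` for a request at `r`. -/
def Prefers (k : ℕ) (δ r : ℝ) (s g : Fin (2 * k)) : Prop :=
  (s < g → r ≤ threshold k δ s g) ∧ (g < s → threshold k δ g s < r)

/-! ### Splits of intervals of servers and the resulting preferences. -/

theorem adjacentPairs_gap {m : ℕ} {S : Finset (Fin m)} {q : Fin m × Fin m}
    (h : q ∈ adjacentPairs S) : q.1 ∈ S ∧ q.2 ∈ S ∧ q.1 < q.2 ∧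
      ∀ t ∈ S, t ≤ q.1 ∨ q.2 ≤ t := by
  simpa [adjacentPairs, and_assoc] using h

/-- An interval contains the successor of the smaller server, which must not lie strictly between
the two. -/
theorem adjacentPairs_val {m : ℕ} {S : Finset (Fin m)} (hS : (S : Set (Fin m)).OrdConnected)
    {q : Fin m × Fin m} (h : q ∈ adjacentPairs S) : (q.2 : ℕ) = q.1 + 1 := by
  obtain ⟨h1, h2, h3, h4⟩ := adjacentPairs_gap h
  have h3' : (q.1 : ℕ) < q.2 := h3
  let t : Fin m := ⟨q.1 + 1, by omega⟩
  have ht : t ∈ S := hS.out h1 h2 ⟨Fin.le_def.2 (by simp [t]), Fin.le_def.2 (by simp [t]; omega)⟩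
  rcases h4 t ht with h | h
  · have := Fin.le_def.1 h
    simp [t] at this
  · have := Fin.le_def.1 h
    simp [t] at this
    omega

theorem mem_adjacentPairs_of_val {m : ℕ} {S : Finset (Fin m)} {i j : Fin m} (hi : i ∈ S)
    (hj : j ∈ S) (hij : (j : ℕ) = i + 1) : (i, j) ∈ adjacentPairs S := by
  simp only [adjacentPairs, mem_filter, mem_product]
  refine ⟨⟨hi, hj⟩, Fin.lt_def.2 (by omega), fun t _ => ?_⟩
  simp only [Fin.le_def]
  omega

/-- A pair of adjacent servers of an interval whose gap is larger than all other gaps is the pair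
at which PTCP splits the interval. -/
theorem splitPair_eq {m : ℕ} (p : Fin m → ℝ) {S : Finset (Fin m)} (h : 2 ≤ S.card)
    (hS : (S : Set (Fin m)).OrdConnected) {i j : Fin m} (hi : i ∈ S) (hj : j ∈ S)
    (hij : (j : ℕ) = i + 1) (hmax : ∀ a ∈ S, ∀ b ∈ S, (b : ℕ) = a + 1 → a ≠ i →
      p b - p a < p j - p i) : splitPair p S h = (i, j) := by
  obtain ⟨h1, h2⟩ := splitPair_spec p S h
  have h3 := h2 _ (mem_adjacentPairs_of_val hi hj hij)
  have h4 := adjacentPairs_gap h1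
  have h5 := adjacentPairs_val hS h1
  have h6 : (splitPair p S h).1 = i := by
    by_contra hne
    exact absurd (hmax _ h4.1 _ h4.2.1 h5 hne) (not_lt.2 h3)
  refine Prod.ext h6 (Fin.ext ?_)
  rw [h5, h6, hij]

theorem two_le_card_Ici {m : ℕ} {i : Fin m} (h : 2 ≤ (Ici i).card) : (i : ℕ) + 1 < m := by
  rw [Fin.card_Ici] at h
  omega

/-- The gaps shrink to the right, so the split isolates `i`. The set `S` is tied to `Ici i` by an
equation only, so that the induction hypothesis applies directly to the recursive call on
`rightPart`. -/
theorem prefers_of_Ici {k : ℕ} {δ : ℝ} (h0 : 0 < δ) (h1 : δ < 1) (r : ℝ) (d : ℕ) :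
    ∀ i : Fin (2 * k), k ≤ (i : ℕ) → 2 * k - i = d → ∀ (S F : Finset (Fin (2 * k))) (hFS : F ⊆ S)
      (hF : F.Nonempty), S = Ici i → ∀ g ∈ F, g ≠ (ptcpServer (layout k δ) r S F hFS hF).1 →
        Prefers k δ r (ptcpServer (layout k δ) r S F hFS hF).1 g := by
  induction d with
  | zero => intro i _ hd; omega
  | succ d ih =>
    intro i hi hd S F hFS hF hS g hg hgs
    rcases ptcpServer_cases (layout k δ) r S F hFS hF with hc | ⟨h2, hcase⟩
    · exact absurd (card_le_one.1 hc.le g hg _ (Subtype.prop _)) hgs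
    have hi1 : (i : ℕ) + 1 < 2 * k := two_le_card_Ici (hS ▸ h2)
    set j : Fin (2 * k) := ⟨i + 1, hi1⟩ with hj
    have hji : (j : ℕ) = i + 1 := rfl
    have hiS : i ∈ S := by simp [hS]
    have hjS : j ∈ S := by simp [hS, Fin.le_def, hji]
    have hsplit : splitPair (layout k δ) S h2 = (i, j) := by
      refine splitPair_eq _ h2 (by rw [hS, coe_Ici]; exact Set.ordConnected_Ici) hiS hjS rfl ?_
      intro a ha b hb hab hai
      rw [hS, mem_Ici, Fin.le_def] at ha
      have hai' : (a : ℕ) ≠ i := fun h => hai (Fin.ext h)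
      rw [layout_right (show k ≤ (b : ℕ) by omega), layout_right (show k ≤ (a : ℕ) by omega),
        layout_right hi, layout_right (show k ≤ (j : ℕ) by omega), hab, hji,
        show (a : ℕ) + 1 + 1 - k = a + 1 - k + 1 by omega,
        show (i : ℕ) + 1 + 1 - k = i + 1 - k + 1 by omega, radius_succ h1, radius_succ h1]
      have := pow_lt_pow_right_of_lt_one₀ h0 h1 (show (i : ℕ) + 1 - k < a + 1 - k by omega)
      linarith
    have hleft : leftPart (layout k δ) S h2 = {i} := by
      ext t
      rw [leftPart, hsplit, mem_filter, hS, mem_Ici, mem_singleton]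
      exact ⟨fun h => le_antisymm h.2 h.1, fun h => by simp [h]⟩
    have hright : rightPart (layout k δ) S h2 = Ici j := by
      ext t
      rw [rightPart, hsplit, mem_filter, hS, mem_Ici, mem_Ici, Fin.le_def, Fin.le_def]
      dsimp only
      omega
    -- Here `Δ₁ = 0`, since the left part is a single server.
    have hcrit : criticalPoint (layout k δ) S h2 = critical k δ (rank k i) := by
      have hne : S.Nonempty := ⟨i, hiS⟩
      have hmin : S.min' hne = i :=
        le_antisymm (min'_le _ _ hiS) (le_min' _ _ _ fun t ht => by simpa [hS] using ht)
      have hl : 2 * k - 1 < 2 * k := by omega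
      have hmax : S.max' hne = ⟨2 * k - 1, hl⟩ :=
        le_antisymm (Fin.le_def.2 (by have := (S.max' hne).2; simp; omega))
          (le_max' _ _ (by simp [hS, Fin.le_def]; omega))
      have hD := pow_pos h0 (i + 1 - k)
      have hm := (radius_strictMono h0 h1).monotone (show (i : ℕ) + 1 - k + 1 ≤ k by omega)
      simp only [criticalPoint, hsplit, hmin, hmax]
      rw [layout_right hi, layout_right (show k ≤ (j : ℕ) by omega), hji,
        layout_right (by simp; omega), show (i : ℕ) + 1 + 1 - k = i + 1 - k + 1 by omega]
      simp only [critical, rank, not_lt.2 hi, if_false]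
      rw [show 2 * k - 1 + 1 - k = k by omega]
      rw [radius_succ h1] at hm ⊢
      rw [mul_div_assoc, mul_comm (δ ^ _)]
      congr 1
      rw [mul_comm, mul_comm _ (δ ^ _), ← mul_div_assoc, ← mul_div_assoc]
      congr 1 <;> ring
    rcases hcase with ⟨hr, hne, heq⟩ | ⟨hr, hne, heq⟩
    · have hs : (ptcpServer (layout k δ) r S F hFS hF).1 = i := by
        have := (mem_inter.1 (ptcpServer (layout k δ) r (leftPart (layout k δ) S h2)
          (F ∩ leftPart (layout k δ) S h2) inter_subset_right hne).2).2
        rw [← heq, hleft] at this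
        simpa using this
      rw [hs] at hgs ⊢
      have hgi : i ≤ g := by simpa [hS] using hFS hg
      have hig : i < g := lt_of_le_of_ne hgi hgs.symm
      refine ⟨fun _ => ?_, fun h => absurd h (not_lt.2 hgi)⟩
      rcases hr with hr | hr
      · have hgk : ¬ (g : ℕ) < k := by have := Fin.lt_def.1 hig; omega
        rw [threshold, if_neg hgk, if_pos hi, ← hcrit]
        exact hr
      · refine absurd (mem_inter.2 ⟨hg, ?_⟩) (hr ▸ notMem_empty g)
        rw [hright, mem_Ici]
        exact Fin.le_def.2 (by have := Fin.lt_def.1 hig; omega)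
    · have hmem := (mem_inter.1 (ptcpServer (layout k δ) r (rightPart (layout k δ) S h2)
          (F ∩ rightPart (layout k δ) S h2) inter_subset_right hne).2).2
      rw [heq] at hgs ⊢
      replace hmem := (Finset.ext_iff.1 hright _).1 hmem
      have hjs := Fin.le_def.1 (mem_Ici.1 hmem)
      by_cases hgi : g = i
      · subst hgi
        refine ⟨fun h => ?_, fun _ => ?_⟩
        · have := Fin.lt_def.1 h
          omega
        · rw [threshold, if_neg (by omega), if_pos hi, ← hcrit]
          exact hr ⟨g, by simp [hg, hleft]⟩
      · refine ih j (by omega) (by omega) _ _ _ _ hright g (mem_inter.2 ⟨hg, ?_⟩) hgs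
        have h3 : i ≤ g := by simpa [hS] using hFS hg
        have h4 := Fin.lt_def.1 (lt_of_le_of_ne h3 (Ne.symm hgi))
        rw [hright, mem_Ici, Fin.le_def]
        omega

/-- The mirror image of `prefers_of_Ici`, except for ties: a request at the critical point still
goes left, which is outwards here. -/
theorem prefers_of_Iic {k : ℕ} {δ : ℝ} (h0 : 0 < δ) (h1 : δ < 1) (r : ℝ) (d : ℕ) :
    ∀ i : Fin (2 * k), (i : ℕ) < k → (i : ℕ) = d → ∀ (S F : Finset (Fin (2 * k))) (hFS : F ⊆ S)
      (hF : F.Nonempty), S = Iic i → ∀ g ∈ F, g ≠ (ptcpServer (layout k δ) r S F hFS hF).1 →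
        Prefers k δ r (ptcpServer (layout k δ) r S F hFS hF).1 g := by
  induction d with
  | zero =>
    intro i hi hd S F hFS hF hS g hg hgs
    have h2 : ∀ t ∈ F, t = i := fun t ht => by
      have := Fin.le_def.1 (mem_Iic.1 (hS ▸ hFS ht))
      exact Fin.ext (by omega)
    exact absurd ((h2 g hg).trans (h2 _ (Subtype.prop _)).symm) hgs
  | succ d ih =>
    intro i hi hd S F hFS hF hS g hg hgs
    rcases ptcpServer_cases (layout k δ) r S F hFS hF with hc | ⟨h2, hcase⟩
    · exact absurd (card_le_one.1 hc.le g hg _ (Subtype.prop _)) hgs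
    set j : Fin (2 * k) := ⟨d, by omega⟩ with hj
    have hji : (i : ℕ) = j + 1 := hd
    have hjd : (j : ℕ) = d := rfl
    have hiS : i ∈ S := by simp [hS]
    have hjS : j ∈ S := by rw [hS, mem_Iic, Fin.le_def]; omega
    have hsplit : splitPair (layout k δ) S h2 = (j, i) := by
      refine splitPair_eq _ h2 (by rw [hS, coe_Iic]; exact Set.ordConnected_Iic) hjS hiS hd ?_
      intro a ha b hb hab haj
      rw [hS, mem_Iic, Fin.le_def] at hb
      have haj' : (a : ℕ) ≠ j := fun h => haj (Fin.ext h)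
      rw [layout_left (show (b : ℕ) < k by omega), layout_left (show (a : ℕ) < k by omega),
        layout_left hi, layout_left (show (j : ℕ) < k by omega),
        show k - (a : ℕ) = k - b + 1 by omega,
        show k - (j : ℕ) = k - i + 1 by omega, radius_succ h1, radius_succ h1]
      have := pow_lt_pow_right_of_lt_one₀ h0 h1 (show k - (i : ℕ) < k - b by omega)
      linarith
    have hright : rightPart (layout k δ) S h2 = {i} := by
      ext t
      rw [rightPart, hsplit, mem_filter, hS, mem_Iic, mem_singleton]
      exact ⟨fun h => le_antisymm h.1 h.2, fun h => by simp [h]⟩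
    have hleft : leftPart (layout k δ) S h2 = Iic j := by
      ext t
      rw [leftPart, hsplit, mem_filter, hS, mem_Iic, mem_Iic, Fin.le_def, Fin.le_def]
      dsimp only
      omega
    have hcrit : criticalPoint (layout k δ) S h2 = -critical k δ (rank k i) := by
      have hne : S.Nonempty := ⟨i, hiS⟩
      have hmax : S.max' hne = i :=
        le_antisymm (max'_le _ _ _ fun t ht => by simpa [hS] using ht) (le_max' _ _ hiS)
      have hl : 0 < 2 * k := by omega
      have hmin : S.min' hne = ⟨0, hl⟩ :=
        le_antisymm (min'_le _ _ (by simp [hS, Fin.le_def])) (Fin.le_def.2 (by simp))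
      have hD := pow_pos h0 (k - i)
      have hm := (radius_strictMono h0 h1).monotone (show k - (i : ℕ) + 1 ≤ k by omega)
      simp only [criticalPoint, hsplit, hmin, hmax]
      rw [layout_left hi, layout_left (show (j : ℕ) < k by omega),
        layout_left (by simp; omega), show k - (j : ℕ) = k - i + 1 by omega]
      simp only [critical, rank, hi, if_true]
      rw [radius_succ h1] at hm ⊢
      simp only [Nat.sub_zero]
      generalize radius δ k = x at *
      generalize radius δ (k - i) = y at *
      generalize δ ^ (k - (i : ℕ)) = D at *
      have : D + (x - y) ≠ 0 := by linarith
      have : x - y + D ≠ 0 := by linarith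
      rw [show -(y + D) - -x + (-y - -(y + D)) + (-y - -y + (-y - -(y + D))) = D + (x - y) by ring]
      field_simp
      ring
    rcases hcase with ⟨hr, hne, heq⟩ | ⟨hr, hne, heq⟩
    · have hmem := (mem_inter.1 (ptcpServer (layout k δ) r (leftPart (layout k δ) S h2)
          (F ∩ leftPart (layout k δ) S h2) inter_subset_right hne).2).2
      rw [heq] at hgs ⊢
      replace hmem := (Finset.ext_iff.1 hleft _).1 hmem
      have hjs := Fin.le_def.1 (mem_Iic.1 hmem)
      by_cases hgi : g = i
      · subst hgi
        refine ⟨fun _ => ?_, fun h => ?_⟩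
        · rw [threshold, if_pos hi, ← hcrit]
          rcases hr with hr | hr
          · exact hr
          · exact absurd (mem_inter.2 ⟨hg, by simp [hright]⟩) (hr ▸ notMem_empty g)
        · have := Fin.lt_def.1 h
          omega
      · refine ih j (by omega) rfl _ _ _ _ hleft g (mem_inter.2 ⟨hg, ?_⟩) hgs
        have h3 : g ≤ i := by simpa [hS] using hFS hg
        have h4 := Fin.lt_def.1 (lt_of_le_of_ne h3 hgi)
        rw [hleft, mem_Iic, Fin.le_def]
        omega
    · have hs : (ptcpServer (layout k δ) r S F hFS hF).1 = i := by
        have := (mem_inter.1 (ptcpServer (layout k δ) r (rightPart (layout k δ) S h2)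
          (F ∩ rightPart (layout k δ) S h2) inter_subset_right hne).2).2
        rw [← heq, hright] at this
        simpa using this
      rw [hs] at hgs ⊢
      have hgi : g ≤ i := by simpa [hS] using hFS hg
      have hig : g < i := lt_of_le_of_ne hgi hgs
      refine ⟨fun h => absurd h (not_lt.2 hgi), fun _ => ?_⟩
      rw [threshold, if_pos hi, ← hcrit]
      refine hr ⟨g, mem_inter.2 ⟨hg, ?_⟩⟩
      rw [hleft, mem_Iic]
      exact Fin.le_def.2 (by have := Fin.lt_def.1 hig; omega)

/-- PTCP picks the most preferred free server. -/
theorem prefers_ptcpServer {k : ℕ} {δ : ℝ} (h0 : 0 < δ) (h1 : δ < 1) (r : ℝ)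
    (F : Finset (Fin (2 * k))) (hF : F.Nonempty) : ∀ g ∈ F,
      g ≠ (ptcpServer (layout k δ) r univ F (subset_univ F) hF).1 →
        Prefers k δ r (ptcpServer (layout k δ) r univ F (subset_univ F) hF).1 g := by
  intro g hg hgs
  rcases ptcpServer_cases (layout k δ) r univ F (subset_univ F) hF with hc | ⟨h2, hcase⟩
  · exact absurd (card_le_one.1 hc.le g hg _ (Subtype.prop _)) hgs
  have hk : 1 ≤ k := by
    rw [card_univ, Fintype.card_fin] at h2
    omega
  set i : Fin (2 * k) := ⟨k - 1, by omega⟩ with hi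
  set j : Fin (2 * k) := ⟨k, by omega⟩ with hj
  have hik : (i : ℕ) = k - 1 := rfl
  have hjk : (j : ℕ) = k := rfl
  have hpi : layout k δ i = -1 := by
    rw [layout_left (by omega), show k - (i : ℕ) = 1 by omega, radius_one h1]
  have hpj : layout k δ j = 1 := by
    rw [layout_right (by omega), show (j : ℕ) + 1 - k = 1 by omega, radius_one h1]
  have hsplit : splitPair (layout k δ) univ h2 = (i, j) := by
    refine splitPair_eq _ h2 (by rw [coe_univ]; exact Set.ordConnected_univ) (mem_univ _)
      (mem_univ _) (by omega) ?_
    intro a _ b _ hab hai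
    have hai' : (a : ℕ) ≠ i := fun h => hai (Fin.ext h)
    -- The central gap is 2; every other gap is a positive power of `δ`, hence below 1.
    rw [hpi, hpj]
    rcases lt_or_ge (a : ℕ) k with ha | ha
    · rw [layout_left ha, layout_left (show (b : ℕ) < k by omega),
        show k - (a : ℕ) = k - b + 1 by omega, radius_succ h1]
      have := pow_lt_one₀ h0.le h1 (show k - (b : ℕ) ≠ 0 by omega)
      linarith
    · rw [layout_right ha, layout_right (show k ≤ (b : ℕ) by omega), hab,
        show (a : ℕ) + 1 + 1 - k = a + 1 - k + 1 by omega, radius_succ h1]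
      have := pow_lt_one₀ h0.le h1 (show (a : ℕ) + 1 - k ≠ 0 by omega)
      linarith
  have hleft : leftPart (layout k δ) univ h2 = Iic i := by
    ext t
    simp [leftPart, hsplit]
  have hright : rightPart (layout k δ) univ h2 = Ici j := by
    ext t
    simp [rightPart, hsplit]
  -- By symmetry `Δ₁ = Δ₂`, so the critical point is the midpoint of the central gap.
  have hcrit : criticalPoint (layout k δ) univ h2 = 0 := by
    have hne : (univ : Finset (Fin (2 * k))).Nonempty := ⟨i, mem_univ i⟩
    have hl : 0 < 2 * k := by omega
    have hl' : 2 * k - 1 < 2 * k := by omega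
    have hmin : (univ : Finset (Fin (2 * k))).min' hne = ⟨0, hl⟩ :=
      le_antisymm (min'_le _ _ (mem_univ _)) (Fin.le_def.2 (by simp))
    have hmax : (univ : Finset (Fin (2 * k))).max' hne = ⟨2 * k - 1, hl'⟩ :=
      le_antisymm (Fin.le_def.2 (by
        have := ((univ : Finset (Fin (2 * k))).max' hne).2; simp only; omega))
        (le_max' _ _ (mem_univ _))
    have hm := one_le_radius h0 h1 hk
    simp only [criticalPoint, hsplit, hmin, hmax, hpi, hpj]
    rw [layout_left (j := ⟨0, hl⟩) (by simp; omega),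
      layout_right (j := ⟨2 * k - 1, hl'⟩) (by simp; omega)]
    simp only [Nat.sub_zero, show 2 * k - 1 + 1 - k = k by omega]
    generalize radius δ k = x at *
    have : x + 1 ≠ 0 := by linarith
    rw [show x - 1 + (1 - -1 : ℝ) = x + 1 by ring, show -1 - -x + (1 - -1 : ℝ) = x + 1 by ring]
    field_simp
    ring
  rcases hcase with ⟨hr, hne, heq⟩ | ⟨hr, hne, heq⟩
  · have hmem := (mem_inter.1 (ptcpServer (layout k δ) r (leftPart (layout k δ) univ h2)
        (F ∩ leftPart (layout k δ) univ h2) inter_subset_right hne).2).2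
    rw [heq] at hgs ⊢
    replace hmem := (Finset.ext_iff.1 hleft _).1 hmem
    have hs := Fin.le_def.1 (mem_Iic.1 hmem)
    rcases lt_or_ge (g : ℕ) k with hgk | hgk
    · refine prefers_of_Iic h0 h1 r _ i (by omega) rfl _ _ _ _ hleft g (mem_inter.2 ⟨hg, ?_⟩) hgs
      rw [hleft, mem_Iic, Fin.le_def]
      omega
    · refine ⟨fun _ => ?_, fun h => ?_⟩
      · rw [threshold, if_neg (by omega), if_neg (by omega), ← hcrit]
        rcases hr with hr | hr
        · exact hr
        · refine absurd (mem_inter.2 ⟨hg, ?_⟩) (hr ▸ notMem_empty g)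
          rw [hright, mem_Ici, Fin.le_def]
          omega
      · have := Fin.lt_def.1 h
        omega
  · have hmem := (mem_inter.1 (ptcpServer (layout k δ) r (rightPart (layout k δ) univ h2)
        (F ∩ rightPart (layout k δ) univ h2) inter_subset_right hne).2).2
    rw [heq] at hgs ⊢
    replace hmem := (Finset.ext_iff.1 hright _).1 hmem
    have hs := Fin.le_def.1 (mem_Ici.1 hmem)
    rcases lt_or_ge (g : ℕ) k with hgk | hgk
    · refine ⟨fun h => ?_, fun _ => ?_⟩
      · have := Fin.lt_def.1 h
        omega
      · rw [threshold, if_neg (by omega), if_neg (by omega), ← hcrit]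
        refine hr ⟨g, mem_inter.2 ⟨hg, ?_⟩⟩
        rw [hleft, mem_Iic, Fin.le_def]
        omega
    · refine prefers_of_Ici h0 h1 r _ j (by omega) rfl _ _ _ _ hright g (mem_inter.2 ⟨hg, ?_⟩) hgs
      rw [hright, mem_Ici, Fin.le_def]
      omega

/-! ### Two-sided layouts and the potential of a discrepancy -/

/-- Servers on two sides (`1` and `-1`) of the origin, at the distances `n` from it, with the
distances `θ` of critical points behind them. -/
structure TwoSided {m : ℕ} (sd n θ : Fin m → ℝ) (X : ℝ) : Prop where
  sd_cases : ∀ j, sd j = 1 ∨ sd j = -1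
  one_le : ∀ j, 1 ≤ n j
  le_max : ∀ j, n j ≤ X
  lt_crit : ∀ i j, sd i = sd j → n i < n j → n i < θ i
  crit_lt : ∀ i j, sd i = sd j → n i < n j → θ i < n j
  inj : ∀ i j, sd i = sd j → n i = n j → i = j

/-- The server `s` is preferred to the server `g` for a request at `r`, up to ties. -/
structure Pref {m : ℕ} (sd n θ : Fin m → ℝ) (r : ℝ) (s g : Fin m) : Prop where
  opp : sd s ≠ sd g → 0 ≤ sd s * r
  inner : sd s = sd g → n s < n g → sd s * r ≤ θ s
  outer : sd s = sd g → n g < n s → θ g ≤ sd s * r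

open Classical in
/-- A bound for the way from `b` back to the origin, when first all servers of `G` behind `b` are
visited. -/
noncomputable def wayBack {m : ℕ} (sd n : Fin m → ℝ) (X : ℝ) (G : Finset (Fin m)) (b : Fin m) : ℝ :=
  if ∃ g ∈ G, sd g = sd b ∧ n b < n g then 2 * X - n b else n b

open Classical in
/-- A bound for the future excess cost of a run that has a free place at `a` over a run that has it
at `b` instead, where `G` is the set of the servers that are free in both. -/
noncomputable def potential {m : ℕ} (sd n : Fin m → ℝ) (X : ℝ) (G : Finset (Fin m))
    (a b : Fin m) : ℝ :=
  if sd a = sd b then (if n b < n a then n a - n b else wayBack sd n X G b - n a)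
  else wayBack sd n X G b + n a

section Potential

variable {m : ℕ} {sd n θ : Fin m → ℝ} {X : ℝ}

theorem TwoSided.eq_neg (H : TwoSided sd n θ X) {i j : Fin m} (h : sd i ≠ sd j) :
    sd i = -sd j := by
  rcases H.sd_cases i with h1 | h1 <;> rcases H.sd_cases j with h2 | h2 <;> simp_all

theorem TwoSided.eq_of_ne (H : TwoSided sd n θ X) {i j l : Fin m} (h : sd i ≠ sd j)
    (h' : sd j ≠ sd l) : sd i = sd l := by
  rw [H.eq_neg h, H.eq_neg h', neg_neg]

theorem TwoSided.mul_self (H : TwoSided sd n θ X) (i : Fin m) : sd i * sd i = 1 := by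
  rcases H.sd_cases i with h1 | h1 <;> simp [h1]

theorem TwoSided.abs_sub (H : TwoSided sd n θ X) (r : ℝ) {i j : Fin m} (h : sd i = sd j) :
    |r - sd i * n i| = |sd j * r - n i| := by
  rw [h]
  rcases H.sd_cases j with h1 | h1
  · simp [h1]
  · rw [h1, ← abs_neg]
    congr 1
    ring

theorem TwoSided.abs_sub_opp (H : TwoSided sd n θ X) (r : ℝ) {i j : Fin m} (h : sd i ≠ sd j) :
    |r - sd i * n i| = |sd j * r + n i| := by
  rw [H.eq_neg h]
  rcases H.sd_cases j with h1 | h1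
  · simp [h1]
  · rw [h1, ← abs_neg]
    congr 1
    ring

theorem TwoSided.abs_sub_abs_same (H : TwoSided sd n θ X) (r : ℝ) {i j : Fin m}
    (h : sd i = sd j) : |r - sd i * n i| - |r - sd j * n j| ≤ |n i - n j| := by
  rw [H.abs_sub r h, H.abs_sub r rfl, abs_sub_comm (n i)]
  have h3 := abs_sub_abs_le_abs_sub (sd j * r - n i) (sd j * r - n j)
  rwa [show sd j * r - n i - (sd j * r - n j) = n j - n i by ring] at h3

theorem TwoSided.abs_sub_abs_opp (H : TwoSided sd n θ X) (r : ℝ) {i j : Fin m}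
    (h : sd i ≠ sd j) : |r - sd i * n i| - |r - sd j * n j| ≤ n i + n j := by
  rw [H.abs_sub_opp r h, H.abs_sub r rfl]
  have h1 := H.one_le i
  have h2 := H.one_le j
  have h3 := abs_sub_abs_le_abs_sub (sd j * r + n i) (sd j * r - n j)
  rw [show sd j * r + n i - (sd j * r - n j) = n i + n j by ring,
    abs_of_nonneg (show 0 ≤ n i + n j by linarith)] at h3
  exact h3

/-- A request at a server is not between a server and the critical point behind it. -/
theorem TwoSided.le_of_le_crit (H : TwoSided sd n θ X) {i o : Fin m} (h : sd i * (sd o * n o) ≤ θ i) : sd i * (sd o * n o) ≤ n i := by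
  have h1 := H.one_le i
  have h2 := H.one_le o
  by_cases ho : sd i = sd o
  · rw [← mul_assoc, ← ho, H.mul_self, one_mul] at h ⊢
    by_contra hlt
    exact absurd (H.crit_lt i o ho (not_le.1 hlt)) (not_lt.2 h)
  · rw [← mul_assoc, H.eq_neg ho, neg_mul, H.mul_self]
    linarith

/-- No server is within distance 1 of the origin, so for requests at servers the weak inequality
`Pref.opp` improves to a bound by 1. -/
theorem TwoSided.one_le_abs (H : TwoSided sd n θ X) (i o : Fin m) :
    1 ≤ sd i * (sd o * n o) ∨ sd i * (sd o * n o) ≤ -1 := by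
  have h2 := H.one_le o
  by_cases ho : sd i = sd o
  · rw [← mul_assoc, ← ho, H.mul_self]
    left; linarith
  · rw [← mul_assoc, H.eq_neg ho, neg_mul, H.mul_self]
    right; linarith

/-- Preferences for a request at a server, in terms of the servers only. -/
theorem Pref.at_server (H : TwoSided sd n θ X) {s g o : Fin m} (h : Pref sd n θ (sd o * n o) s g) :
    (sd s ≠ sd g → 1 ≤ sd s * (sd o * n o)) ∧
    (sd s = sd g → n s < n g → sd s * (sd o * n o) ≤ n s) ∧
    (sd s = sd g → n g < n s → n g < sd s * (sd o * n o)) := by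
  refine ⟨fun h1 => ?_, fun h1 h2 => H.le_of_le_crit (h.inner h1 h2), fun h1 h2 => ?_⟩
  · have := h.opp h1
    rcases H.one_le_abs s o with h3 | h3 <;> linarith
  · exact (H.lt_crit g s h1.symm h2).trans_le (h.outer h1 h2)

theorem TwoSided.le_wayBack (H : TwoSided sd n θ X) (G : Finset (Fin m)) (b : Fin m) :
    n b ≤ wayBack sd n X G b := by
  have := H.le_max b
  unfold wayBack
  split_ifs <;> linarith

theorem TwoSided.wayBack_le (H : TwoSided sd n θ X) (G : Finset (Fin m)) (b : Fin m) :
    wayBack sd n X G b ≤ 2 * X - n b := by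
  have := H.le_max b
  unfold wayBack
  split_ifs <;> linarith

theorem TwoSided.wayBack_mono (H : TwoSided sd n θ X) {G G' : Finset (Fin m)} (h : G' ⊆ G)
    (b : Fin m) : wayBack sd n X G' b ≤ wayBack sd n X G b := by
  have := H.le_max b
  unfold wayBack
  split_ifs with h1 h2
  · exact le_rfl
  · obtain ⟨g, hg, hg'⟩ := h1
    exact absurd ⟨g, h hg, hg'⟩ h2
  · linarith
  · exact le_rfl

/-- The two runs can differ by the distance of `a` and `b` when the discrepancy vanishes. -/
theorem TwoSided.abs_sub_abs_le_potential (H : TwoSided sd n θ X) (G : Finset (Fin m)) (r : ℝ)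
    (a b : Fin m) : |r - sd a * n a| - |r - sd b * n b| ≤ potential sd n X G a b := by
  have h1 := H.le_wayBack G b
  unfold potential
  split_ifs with h h'
  · refine (H.abs_sub_abs_same r h).trans ?_
    rw [abs_of_pos (by linarith)]
  · refine (H.abs_sub_abs_same r h).trans ?_
    rw [abs_of_nonpos (by linarith)]
    linarith
  · refine (H.abs_sub_abs_opp r h).trans ?_
    linarith

theorem TwoSided.potential_nonneg (H : TwoSided sd n θ X) (G : Finset (Fin m)) (a b : Fin m) :
    0 ≤ potential sd n X G a b := by
  have h1 := H.le_wayBack G b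
  have h2 := H.one_le a
  have h3 := H.one_le b
  unfold potential
  split_ifs <;> linarith

/-- Moving along one side, away from the origin or back. -/
theorem TwoSided.wayBack_move (H : TwoSided sd n θ X) {G G' : Finset (Fin m)} (hG : G' ⊆ G)
    {b g o : Fin m} (hg : g ∈ G) (hs : sd b = sd g) (hbg : b ≠ g)
    (h1 : Pref sd n θ (sd o * n o) b g)
    (h3 : ∀ g' ∈ G, g' ≠ g → Pref sd n θ (sd o * n o) g g') :
    |sd o * n o - sd g * n g| - |sd o * n o - sd b * n b| + wayBack sd n X G' g ≤
      wayBack sd n X G b := by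
  have hd := H.abs_sub_abs_same (sd o * n o) hs.symm
  obtain ⟨-, -, h1c⟩ := h1.at_server H
  rcases lt_trichotomy (n b) (n g) with hlt | heq | hlt
  · have : wayBack sd n X G b = 2 * X - n b := if_pos ⟨g, hg, hs.symm, hlt⟩
    have := H.wayBack_le G' g
    rw [abs_of_pos (sub_pos.2 hlt)] at hd
    linarith
  · exact absurd (H.inj _ _ hs heq) hbg
  · have h4 := h1c hs hlt
    -- Inwards: the request lies beyond `g`, so `g` could not beat a common free server behind it.
    -- Hence there is none, and no detour is left.
    have : wayBack sd n X G' g = n g := by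
      refine if_neg ?_
      rintro ⟨g', hg', hs', hn'⟩
      have hne : g' ≠ g := by rintro rfl; exact lt_irrefl _ hn'
      have h5 := ((h3 g' (hG hg') hne).at_server H).2.1 hs'.symm hn'
      rw [hs] at h4
      linarith
    have := H.le_wayBack G b
    rw [abs_of_neg (sub_neg.2 hlt)] at hd
    linarith

/-- The free place of the second run moves from `b` to `g`. -/
theorem TwoSided.potential_move_right (H : TwoSided sd n θ X) {G G' : Finset (Fin m)} (hG : G' ⊆ G)
    {a b g o : Fin m} (hg : g ∈ G) (hbg : b ≠ g) (hga : g ≠ a) (hab : a ≠ b)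
    (h1 : Pref sd n θ (sd o * n o) b g) (h2 : Pref sd n θ (sd o * n o) g a)
    (h3 : ∀ g' ∈ G, g' ≠ g → Pref sd n θ (sd o * n o) g g') :
    |sd o * n o - sd g * n g| - |sd o * n o - sd b * n b| + potential sd n X G' a g ≤
      potential sd n X G a b := by
  obtain ⟨h1a, h1b, h1c⟩ := h1.at_server H
  obtain ⟨h2a, h2b, h2c⟩ := h2.at_server H
  have hwb := H.le_wayBack G b
  by_cases hs : sd b = sd g
  · have hmove := H.wayBack_move hG hg hs hbg h1 h3
    have hd := H.abs_sub_abs_same (sd o * n o) hs.symm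
    by_cases hs' : sd a = sd b
    · have hs'' : sd g = sd a := (hs'.trans hs).symm
      simp only [potential, hs', hs, if_true]
      rw [hs] at h1b h1c
      rw [hs] at hs'
      have hne : n g ≠ n a := fun h => hga (H.inj _ _ hs'' h)
      have hne' : n b ≠ n g := fun h => hbg (H.inj _ _ hs h)
      have hne'' : n a ≠ n b := fun h => hab (H.inj _ _ (hs'.trans hs.symm) h)
      rcases lt_or_gt_of_ne hne'' with hab' | hab'
      · rw [if_neg (not_lt.2 hab'.le)]
        rcases lt_or_gt_of_ne hne with hga' | hga'
        -- Impossible: that `g` beats `a` keeps the request from lying beyond `g`, that `b` beats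
        -- `g` puts it there. The other orders that are ruled out below fail similarly.
        · have := h2b hs'' hga'
          have := h1c rfl (hga'.trans hab')
          linarith
        · rw [if_neg (not_lt.2 hga'.le)]
          rw [← hs] at hmove ⊢
          linarith
      · rw [if_pos hab']
        rcases lt_or_gt_of_ne hne' with hbg' | hbg'
        · have h4 := h1b rfl hbg'
          rcases lt_or_gt_of_ne hne with hga' | hga'
          · rw [if_pos hga']
            rw [abs_of_pos (sub_pos.2 hbg'), ← hs] at hd
            rw [← hs]
            linarith
          · have := h2c hs'' hga'
            linarith
        · have := h1c rfl hbg'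
          have := h2b hs'' (hbg'.trans hab')
          linarith
    · have hs'' : sd a ≠ sd g := hs ▸ hs'
      rw [potential, potential, if_neg hs', if_neg hs'']
      linarith
  · have h4 := h1a hs
    have hgb : sd g = -sd b := by rw [H.eq_neg hs, neg_neg]
    by_cases hs' : sd a = sd b
    -- Impossible: the request would lie on both sides of the origin.
    · have := h2a (by rw [hs']; exact Ne.symm hs)
      rw [hgb] at this
      linarith
    · have hs'' : sd a = sd g := H.eq_of_ne hs' hs
      have hne : n g ≠ n a := fun h => hga (H.inj _ _ hs''.symm h)
      have hd := H.abs_sub_abs_opp (sd o * n o) (Ne.symm hs)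
      rw [potential, potential, if_neg hs', if_pos hs'']
      rcases lt_or_gt_of_ne hne with hga' | hga'
      -- `wayBack` at `b` pays for the way to the origin; the straight way from `g` to `a` remains.
      · rw [if_pos hga']
        linarith
      · have h5 := h2c hs''.symm hga'
        rw [hgb] at h5
        have := H.one_le a
        linarith

/-- The free place of the first run moves from `a` to `g`. -/
theorem TwoSided.potential_move_left (H : TwoSided sd n θ X) {G G' : Finset (Fin m)} (hG : G' ⊆ G)
    {a b g o : Fin m} (hag : a ≠ g) (hgb : g ≠ b) (hab : a ≠ b)
    (h1 : Pref sd n θ (sd o * n o) a g) (h2 : Pref sd n θ (sd o * n o) g b) :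
    |sd o * n o - sd a * n a| - |sd o * n o - sd g * n g| + potential sd n X G' g b ≤
      potential sd n X G a b := by
  obtain ⟨h1a, h1b, h1c⟩ := h1.at_server H
  obtain ⟨h2a, h2b, h2c⟩ := h2.at_server H
  have hwm := H.wayBack_mono hG b
  have hwb := H.le_wayBack G b
  have habs := H.abs_sub (sd o * n o) (i := a) (j := a) rfl
  by_cases hs : sd a = sd g
  · have habs' := H.abs_sub (sd o * n o) hs.symm
    have hd := H.abs_sub_abs_same (sd o * n o) hs
    have hne : n a ≠ n g := fun h => hag (H.inj _ _ hs h)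
    -- An outward move of `a` must lower the excess by exactly the distance moved, because the
    -- potential can grow by that amount; the triangle inequality would be too weak.
    have hout : n a < n g →
        |sd o * n o - sd a * n a| - |sd o * n o - sd g * n g| = n a - n g := by
      intro hlt
      have := h1b hs hlt
      rw [habs, habs', abs_of_nonpos (by linarith), abs_of_nonpos (by linarith)]
      ring
    by_cases hs' : sd g = sd b
    · have hs'' : sd a = sd b := hs.trans hs'
      have hne' : n g ≠ n b := fun h => hgb (H.inj _ _ hs' h)
      have hne'' : n a ≠ n b := fun h => hab (H.inj _ _ hs'' h)
      rw [potential, potential, if_pos hs'', if_pos hs']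
      rw [hs] at h1b h1c
      rcases lt_or_gt_of_ne hne with hlt | hlt
      · have h5 := hout hlt
        rcases lt_or_gt_of_ne hne'' with h6 | h6
        · rw [if_neg (not_lt.2 h6.le)]
          rcases lt_or_gt_of_ne hne' with h7 | h7
          · rw [if_neg (not_lt.2 h7.le)]
            linarith
          · have := h1b rfl hlt
            have := h2c hs' h7
            linarith
        · rw [if_pos h6, if_pos (h6.trans hlt)]
          linarith
      · rw [abs_of_pos (sub_pos.2 hlt)] at hd
        have h5 := h1c rfl hlt
        rcases lt_or_gt_of_ne hne' with h7 | h7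
        · have := h2b hs' h7
          linarith
        · rw [if_pos h7, if_pos (h7.trans hlt)]
          linarith
    · have hs'' : sd a ≠ sd b := hs ▸ hs'
      rw [potential, potential, if_neg hs'', if_neg hs']
      rcases lt_or_gt_of_ne hne with hlt | hlt
      · linarith [hout hlt]
      · rw [abs_of_pos (sub_pos.2 hlt)] at hd
        linarith
  · have h4 := h1a hs
    have hga : sd g = -sd a := by rw [H.eq_neg hs, neg_neg]
    by_cases hs' : sd a = sd b
    · have := h2a (by rw [← hs']; exact Ne.symm hs)
      rw [hga] at this
      linarith
    · have hs'' : sd g = sd b := H.eq_of_ne (Ne.symm hs) hs'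
      have hne : n g ≠ n b := fun h => hgb (H.inj _ _ hs'' h)
      have hd := H.abs_sub_abs_opp (sd o * n o) hs
      rw [potential, potential, if_neg hs', if_pos hs'']
      rcases lt_or_gt_of_ne hne with h7 | h7
      · rw [if_neg (not_lt.2 h7.le)]
        linarith
      · have h5 := h2c hs'' h7
        rw [hga] at h5
        have := H.one_le b
        linarith

/-- The cost of the first discrepancy, between a request at `r` and a request at a server `o`. -/
theorem TwoSided.potential_start (H : TwoSided sd n θ X) {K : ℝ} (hX : 2 * X ≤ K - 1)
    (hK : ∀ i j, sd i = sd j → n i < n j → 2 * (X - n i) ≤ (K - 1) * (n j - n i))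
    (hθ : ∀ i j, sd i = sd j → n i < n j → (K + 1) * (θ i - n i) ≤ (K - 1) * (n j - n i))
    (hθ' : ∀ i j, sd i = sd j → n i < n j → 2 * (X - n i) ≤ (K + 1) * (θ i - n i))
    (G : Finset (Fin m)) {r : ℝ} {s s' o : Fin m} (hss : s ≠ s')
    (h1 : Pref sd n θ r s s') (h2 : Pref sd n θ (sd o * n o) s' s) :
    |r - sd s * n s| - |sd o * n o - sd s' * n s'| + potential sd n X G s' s ≤
      K * |r - sd o * n o| := by
  obtain ⟨h2a, h2b, h2c⟩ := h2.at_server H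
  have hwb := H.wayBack_le G s
  have hXs := H.le_max s
  have hns := H.one_le s
  have hns' := H.one_le s'
  have e1 := H.abs_sub r (i := s) (j := s) rfl
  have hpos : sd s * (r - sd o * n o) ≤ |r - sd o * n o| ∧
      -(sd s * (r - sd o * n o)) ≤ |r - sd o * n o| := by
    rcases H.sd_cases s with h | h <;> rw [h]
    · exact ⟨by linarith [le_abs_self (r - sd o * n o)],
        by linarith [neg_abs_le (r - sd o * n o)]⟩
    · exact ⟨by linarith [neg_abs_le (r - sd o * n o)],
        by linarith [le_abs_self (r - sd o * n o)]⟩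
  have hT : n s < sd s * (sd o * n o) → sd s = sd o ∧ sd s * (sd o * n o) = n o := by
    intro h
    have h3 := H.one_le o
    by_cases ho : sd s = sd o
    · exact ⟨ho, by rw [← mul_assoc, ← ho, H.mul_self, one_mul]⟩
    · rw [← mul_assoc, H.eq_neg ho, neg_mul, H.mul_self] at h
      linarith
  have hK3 : 3 ≤ K := by linarith
  rw [mul_sub] at hpos
  by_cases hs : sd s = sd s'
  · have e2 := H.abs_sub (sd o * n o) hs.symm
    rw [← hs] at h2b h2c
    rw [e1, e2]
    rw [potential, if_pos hs.symm]
    have hr1 := h1.inner hs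
    have hr2 := h1.outer hs
    generalize sd s * r = R at *
    generalize sd s * (sd o * n o) = T at *
    generalize |r - sd o * n o| = A at *
    have hne : n s ≠ n s' := fun h => hss (H.inj _ _ hs h)
    rcases lt_or_gt_of_ne hne with hlt | hlt
    -- `s` is the inner server: `r` is not past the critical point behind `s`, but `o` is beyond
    -- `s`. The upper bound `hθ`, with `o` as the outer server, keeps `r` away from `o`.
    · rw [if_pos hlt]
      have a1 := h2c rfl hlt
      have a2 := hr1 hlt
      obtain ⟨b1, b2⟩ := hT a1
      subst b2
      have b3 := hθ s o b1 a1
      have b4 : K * (n o - R) ≤ K * A := mul_le_mul_of_nonneg_left (by linarith) (by linarith)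
      have b5 : (K + 1) * (R - n s) ≤ (K + 1) * (θ s - n s) :=
        mul_le_mul_of_nonneg_left (by linarith) (by linarith)
      have b6 := neg_abs_le (n o - n s')
      rcases le_total R (n s) with h | h
      · have b7 : 3 * (n o - R) ≤ K * (n o - R) :=
          mul_le_mul_of_nonneg_right hK3 (by linarith)
        rw [abs_of_nonpos (sub_nonpos.2 h)]
        linarith
      · rw [abs_of_nonneg (sub_nonneg.2 h)]
        linarith
    -- `s` is the outer server: `r` has reached the critical point behind `s'`, and `o` is not
    -- beyond `s'`. The lower bound `hθ'` pays for the detour over the far end; if `r` is even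
    -- beyond `s`, `hK` does.
    · rw [if_neg (not_lt.2 hlt.le)]
      have a1 := h2b rfl hlt
      have a2 := hr2 hlt
      have b1 : K * (R - T) ≤ K * A := mul_le_mul_of_nonneg_left hpos.1 (by linarith)
      have b2 := hK s' s hs.symm hlt
      have b3 := hθ' s' s hs.symm hlt
      have b4 : (K + 1) * (θ s' - n s') ≤ (K + 1) * (R - T) :=
        mul_le_mul_of_nonneg_left (by linarith) (by linarith)
      rw [abs_of_nonpos (sub_nonpos.2 a1)]
      rcases le_total R (n s) with h | h
      · rw [abs_of_nonpos (sub_nonpos.2 h)]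
        linarith
      · rw [abs_of_nonneg (sub_nonneg.2 h)]
        have b5 : (K - 1) * (n s - n s') ≤ (K - 1) * (R - T) :=
          mul_le_mul_of_nonneg_left (by linarith) (by linarith)
        linarith
  -- The origin separates `r` from `o`, so they are at distance at least 1, and `2 * X ≤ K - 1` pays
  -- for the detour.
  · have hs' : sd s' = -sd s := by rw [H.eq_neg hs, neg_neg]
    have e2 := H.abs_sub_opp (sd o * n o) (Ne.symm hs)
    rw [e1, e2]
    have a1 := h1.opp hs
    have a2 := h2a (Ne.symm hs)
    rw [hs'] at a2
    rw [potential, if_neg (Ne.symm hs)]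
    generalize sd s * r = R at *
    rw [neg_mul] at a2
    generalize sd s * (sd o * n o) = T at *
    generalize |r - sd o * n o| = A at *
    have b1 : K * (R - T) ≤ K * A := mul_le_mul_of_nonneg_left hpos.1 (by linarith)
    have b2 := neg_abs_le (T + n s')
    have b3 := le_abs_self (T + n s')
    have b4 : (K - 1) * 1 ≤ (K - 1) * (R - T) :=
      mul_le_mul_of_nonneg_left (by linarith) (by linarith)
    rcases le_total R (n s) with h | h
    · rw [abs_of_nonpos (sub_nonpos.2 h)]
      linarith
    · rw [abs_of_nonneg (sub_nonneg.2 h)]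
      linarith

end Potential

/-! ### Competitiveness by moving the requests to their servers -/

theorem mem_free {m : ℕ} {c : Fin m → ℕ} {M : Matching m} {s : Fin m} :
    s ∈ free c M ↔ load M s < c s := by
  simp [free]

theorem OnlineAlgorithm.step_of_nonempty {m : ℕ} {c : Fin m → ℕ} (A : OnlineAlgorithm c)
    {M : Matching m} (r : ℝ) (h : (free c M).Nonempty) :
    A.step M r = M ++ [(r, A.pick M r h)] := dif_pos h

theorem OnlineAlgorithm.step_of_not_nonempty {m : ℕ} {c : Fin m → ℕ} (A : OnlineAlgorithm c)
    {M : Matching m} (r : ℝ) (h : ¬ (free c M).Nonempty) : A.step M r = M := dif_neg h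

theorem cost_snoc {m : ℕ} (p : Fin m → ℝ) (M : Matching m) (r : ℝ) (s : Fin m) :
    cost p (M ++ [(r, s)]) = cost p M + |r - p s| := by
  simp [cost]

theorem load_snoc {m : ℕ} (M : Matching m) (r : ℝ) (s t : Fin m) :
    load (M ++ [(r, s)]) t = load M t + if t = s then 1 else 0 := by
  rw [load_append, load_cons, load_nil, zero_add]

/-- `A` picks the first free server with respect to the asymmetric relations `R r`. -/
def PicksBy {m : ℕ} {c : Fin m → ℕ} (A : OnlineAlgorithm c) (R : ℝ → Fin m → Fin m → Prop) :
    Prop :=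
  (∀ r s g, R r s g → ¬ R r g s) ∧
    ∀ M r h, ∀ g ∈ free c M, g ≠ A.pick M r h → R r (A.pick M r h) g

section Discrepancy

variable {m : ℕ} {c : Fin m → ℕ} {A : OnlineAlgorithm c} {R : ℝ → Fin m → Fin m → Prop}

/-- By asymmetry the pick is determined by the set of free servers, so runs with equal loads stay
together. -/
theorem PicksBy.cost_foldl_of_load_eq (hA : PicksBy A R) (p : Fin m → ℝ) (τ : List ℝ) :
    ∀ M M' : Matching m, (∀ t, load M t = load M' t) →
      cost p (τ.foldl A.step M) - cost p M = cost p (τ.foldl A.step M') - cost p M' := by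
  induction τ with
  | nil => simp
  | cons r τ ih =>
    intro M M' hM
    have hfree : free c M = free c M' := by
      ext t
      rw [mem_free, mem_free, hM]
    rw [List.foldl_cons, List.foldl_cons]
    by_cases h : (free c M).Nonempty
    · have h' : (free c M').Nonempty := hfree ▸ h
      have hpick : A.pick M r h = A.pick M' r h' := by
        by_contra hne
        refine hA.1 _ _ _ (hA.2 M r h _ ?_ (Ne.symm hne)) (hA.2 M' r h' _ ?_ hne)
        · exact hfree ▸ A.pick_mem M' r h'
        · exact hfree ▸ A.pick_mem M r h
      have := ih (A.step M r) (A.step M' r) fun t => by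
        rw [A.step_of_nonempty r h, A.step_of_nonempty r h', load_snoc, load_snoc, hM, hpick]
      rw [A.step_of_nonempty r h, A.step_of_nonempty r h', cost_snoc, cost_snoc, hpick] at this
      rw [A.step_of_nonempty r h, A.step_of_nonempty r h', hpick]
      linarith
    · rw [A.step_of_not_nonempty r h, A.step_of_not_nonempty r (hfree ▸ h)]
      exact ih M M' hM

variable {sd n θ : Fin m → ℝ} {X : ℝ}

theorem TwoSided.potential_mono (H : TwoSided sd n θ X) {G G' : Finset (Fin m)} (h : G' ⊆ G)
    (a b : Fin m) : potential sd n X G' a b ≤ potential sd n X G a b := by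
  have := H.wayBack_mono h b
  unfold potential
  split_ifs <;> linarith

/-- Two runs on requests at servers, whose states differ in one free place. -/
theorem PicksBy.cost_foldl_le (hA : PicksBy A R) (H : TwoSided sd n θ X)
    (hR : ∀ r s g, R r s g → Pref sd n θ r s g) {p : Fin m → ℝ} (hp : ∀ j, p j = sd j * n j)
    (L : List (Fin m)) : ∀ (M M' : Matching m) (h : Fin m → ℕ) (a b : Fin m), a ≠ b →
      (∀ t, load M t + h t + (if t = a then 1 else 0) = c t) →
      (∀ t, load M' t + h t + (if t = b then 1 else 0) = c t) →
      cost p ((L.map p).foldl A.step M) - cost p M ≤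
        cost p ((L.map p).foldl A.step M') - cost p M' +
          potential sd n X (univ.filter fun t => 0 < h t) a b := by
  induction L with
  | nil =>
    intro M M' h a b _ _ _
    simpa using H.potential_nonneg _ a b
  | cons o L ih =>
    -- `h` counts the places free in both runs; `a` and `b` are the private free places of the two.
    intro M M' h a b hab ha hb
    have hfa : ∀ t, t ∈ free c M ↔ 0 < h t ∨ t = a := fun t => by
      rw [mem_free, ← ha t]
      split_ifs <;> simp_all
    have hfb : ∀ t, t ∈ free c M' ↔ 0 < h t ∨ t = b := fun t => by
      rw [mem_free, ← hb t]
      split_ifs <;> simp_all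
    have hn : (free c M).Nonempty := ⟨a, (hfa a).2 (Or.inr rfl)⟩
    have hn' : (free c M').Nonempty := ⟨b, (hfb b).2 (Or.inr rfl)⟩
    rw [List.map_cons, List.foldl_cons, List.foldl_cons, A.step_of_nonempty _ hn,
      A.step_of_nonempty _ hn']
    have hP := (hfa _).1 (A.pick_mem M (p o) hn)
    have hQ := (hfb _).1 (A.pick_mem M' (p o) hn')
    have hP' := hA.2 M (p o) hn
    have hQ' := hA.2 M' (p o) hn'
    generalize A.pick M (p o) hn = P at *
    generalize A.pick M' (p o) hn' = Q at *
    have hsub : ∀ g, (univ.filter fun t => 0 < h t - if t = g then 1 else 0) ⊆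
        univ.filter fun t => 0 < h t := fun g t ht => by
      simp only [mem_filter, mem_univ, true_and] at ht ⊢
      omega
    by_cases hPQ : P = Q
    · subst hPQ
      have h0 : 0 < h P := by
        rcases hP with hP | rfl
        · exact hP
        · exact hQ.resolve_right hab
      have h1 := ih (M ++ [(p o, P)]) (M' ++ [(p o, P)]) (fun t => h t - if t = P then 1 else 0)
        a b hab (fun t => ?_) (fun t => ?_)
      · have h2 := H.potential_mono (hsub P) a b
        rw [cost_snoc, cost_snoc] at h1
        linarith
      · rw [load_snoc, ← ha t]
        by_cases ht : t = P
        · subst ht; simp only [if_true]; omega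
        · simp [ht]
      · rw [load_snoc, ← hb t]
        by_cases ht : t = P
        · subst ht; simp only [if_true]; omega
        · simp [ht]
    · by_cases hPa : P = a
      · subst hPa
        by_cases hQb : Q = b
        -- Both private places are filled and the runs merge.
        · subst hQb
          have h1 := hA.cost_foldl_of_load_eq p (L.map p) (M ++ [(p o, P)]) (M' ++ [(p o, Q)])
            fun t => by
              have := ha t
              have := hb t
              rw [load_snoc, load_snoc]
              omega
          have h2 := H.abs_sub_abs_le_potential (univ.filter fun t => 0 < h t) (p o) P Q
          rw [cost_snoc, cost_snoc] at h1
          rw [← hp, ← hp] at h2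
          linarith
        -- The common place at `Q` is taken by the second run only and becomes the private place of
        -- the first.
        · have h0 : 0 < h Q := hQ.resolve_right hQb
          have h1 := ih (M ++ [(p o, P)]) (M' ++ [(p o, Q)]) (fun t => h t - if t = Q then 1 else 0)
            Q b hQb (fun t => ?_) (fun t => ?_)
          · have r1 := hR _ _ _ (hP' Q ((hfa Q).2 (Or.inl h0)) (Ne.symm hPQ))
            have r2 := hR _ _ _ (hQ' b ((hfb b).2 (Or.inr rfl)) (Ne.symm hQb))
            rw [hp o] at r1 r2
            have h2 := H.potential_move_left (hsub Q) hPQ hQb hab r1 r2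
            rw [← hp, ← hp, ← hp] at h2
            rw [cost_snoc, cost_snoc] at h1
            linarith
          · have := ha t
            rw [load_snoc]
            by_cases ht : t = Q
            · subst ht; simp only [if_true]; omega
            · simp only [ht, if_false]; omega
          · have := hb t
            rw [load_snoc]
            by_cases ht : t = Q
            · subst ht; simp only [if_true]; omega
            · simp only [ht, if_false]; omega
      · have h0 : 0 < h P := hP.resolve_right hPa
        have hRQ := hQ' P ((hfb P).2 (Or.inl h0)) hPQ
        -- Were `Q` also a common place, `P` and `Q` would beat each other.
        have hQb : Q = b := by
          refine hQ.resolve_left fun h0' => ?_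
          exact hA.1 _ _ _ hRQ (hP' Q ((hfa Q).2 (Or.inl h0')) (Ne.symm hPQ))
        subst hQb
        have h1 := ih (M ++ [(p o, P)]) (M' ++ [(p o, Q)]) (fun t => h t - if t = P then 1 else 0)
          a P (Ne.symm hPa) (fun t => ?_) (fun t => ?_)
        · have r1 := hR _ _ _ hRQ
          have r2 := hR _ _ _ (hP' a ((hfa a).2 (Or.inr rfl)) (Ne.symm hPa))
          rw [hp o] at r1 r2
          have h2 := H.potential_move_right (hsub P) (mem_filter.2 ⟨mem_univ P, h0⟩)
            (Ne.symm hPQ) hPa hab r1 r2 fun g hg hgP => by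
              rw [← hp]
              exact hR _ _ _ (hP' g ((hfa g).2 (Or.inl (mem_filter.1 hg).2)) hgP)
          rw [← hp, ← hp, ← hp] at h2
          rw [cost_snoc, cost_snoc] at h1
          linarith
        · have := ha t
          rw [load_snoc]
          by_cases ht : t = P
          · subst ht; simp only [if_true]; omega
          · simp only [ht, if_false]; omega
        · have := hb t
          rw [load_snoc]
          by_cases ht : t = P
          · subst ht; simp only [if_true]; omega
          · simp only [ht, if_false]; omega

/-- Requests at the servers that have room for them cost nothing. -/
theorem PicksBy.cost_foldl_at_servers (hA : PicksBy A R) (H : TwoSided sd n θ X)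
    (hR : ∀ r s g, R r s g → Pref sd n θ r s g) {p : Fin m → ℝ} (hp : ∀ j, p j = sd j * n j)
    (N : Matching m) : ∀ M : Matching m, (∀ t, load M t + load N t ≤ c t) →
      cost p ((N.map fun e => p e.2).foldl A.step M) = cost p M := by
  induction N with
  | nil => simp
  | cons e N ih =>
    intro M hM
    have ho : e.2 ∈ free c M := by
      have := hM e.2
      rw [load_cons, if_pos rfl] at this
      rw [mem_free]
      omega
    have hpick : A.pick M (p e.2) ⟨_, ho⟩ = e.2 := by
      by_contra hne
      have h1 := hR _ _ _ (hA.2 M (p e.2) ⟨_, ho⟩ e.2 ho (Ne.symm hne))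
      generalize A.pick M (p e.2) ⟨_, ho⟩ = s at *
      rw [hp] at h1
      obtain ⟨h2, h3, h4⟩ := h1.at_server H
      by_cases hs : sd s = sd e.2
      · rw [← mul_assoc, hs, H.mul_self, one_mul] at h3 h4
        rcases lt_trichotomy (n s) (n e.2) with h | h | h
        · exact absurd (h3 rfl h) (not_le.2 h)
        · exact hne (H.inj _ _ hs h)
        · exact absurd (h4 rfl h) (lt_irrefl _)
      · have := h2 hs
        rw [← mul_assoc, H.eq_neg hs, neg_mul, H.mul_self] at this
        have := H.one_le e.2
        linarith
    rw [List.map_cons, List.foldl_cons, A.step_of_nonempty _ ⟨_, ho⟩, hpick, ih, cost_snoc,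
      sub_self, abs_zero, add_zero]
    intro t
    have := hM t
    rw [load_cons] at this
    rw [load_snoc]
    omega

/-- The induction hypothesis moves the tail to its servers before the head is moved, so that
`PicksBy.cost_foldl_le` only has to deal with requests at servers. -/
theorem PicksBy.cost_foldl_le_of_matching (hA : PicksBy A R) (H : TwoSided sd n θ X)
    (hR : ∀ r s g, R r s g → Pref sd n θ r s g) {p : Fin m → ℝ} (hp : ∀ j, p j = sd j * n j)
    {K : ℝ} (hX : 2 * X ≤ K - 1)
    (hK : ∀ i j, sd i = sd j → n i < n j → 2 * (X - n i) ≤ (K - 1) * (n j - n i))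
    (hθ : ∀ i j, sd i = sd j → n i < n j → (K + 1) * (θ i - n i) ≤ (K - 1) * (n j - n i))
    (hθ' : ∀ i j, sd i = sd j → n i < n j → 2 * (X - n i) ≤ (K + 1) * (θ i - n i))
    (N : Matching m) : ∀ M : Matching m, (∀ t, load M t ≤ c t) →
      cost p ((N.map Prod.fst).foldl A.step M) ≤
        cost p ((N.map fun e => p e.2).foldl A.step M) + K * cost p N := by
  induction N with
  | nil => simp [cost]
  | cons e N ih =>
    intro M hM
    have hX1 := (H.one_le e.2).trans (H.le_max e.2)
    rw [List.map_cons, List.map_cons, List.foldl_cons, List.foldl_cons, cost_cons]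
    by_cases hn : (free c M).Nonempty
    · have hle : ∀ s ∈ free c M, ∀ (r : ℝ) t, load (M ++ [(r, s)]) t ≤ c t := fun s hs r t => by
        have := hM t
        rw [mem_free] at hs
        rw [load_snoc]
        split_ifs with h
        · subst h; omega
        · omega
      have h1 := ih (A.step M e.1) (by
        rw [A.step_of_nonempty _ hn]
        exact hle _ (A.pick_mem M e.1 hn) e.1)
      rw [mul_add]
      suffices h2 : cost p ((N.map fun e => p e.2).foldl A.step (A.step M e.1)) ≤
          cost p ((N.map fun e => p e.2).foldl A.step (A.step M (p e.2))) + K * |e.1 - p e.2| by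
        linarith
      rw [A.step_of_nonempty _ hn, A.step_of_nonempty _ hn]
      have hP := A.pick_mem M e.1 hn
      have hQ := A.pick_mem M (p e.2) hn
      have hP' := hA.2 M e.1 hn
      have hQ' := hA.2 M (p e.2) hn
      generalize A.pick M e.1 hn = P at *
      generalize A.pick M (p e.2) hn = Q at *
      have hmap : (N.map fun e => p e.2) = (N.map Prod.snd).map p := by simp
      rw [hmap]
      by_cases hPQ : P = Q
      · subst hPQ
        have h3 := hA.cost_foldl_of_load_eq p ((N.map Prod.snd).map p) (M ++ [(e.1, P)])
          (M ++ [(p e.2, P)]) fun t => by rw [load_snoc, load_snoc]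
        rw [cost_snoc, cost_snoc] at h3
        have h4 := abs_sub_abs_le_abs_sub (e.1 - p P) (p e.2 - p P)
        rw [sub_sub_sub_cancel_right] at h4
        have h5 : 1 * |e.1 - p e.2| ≤ K * |e.1 - p e.2| :=
          mul_le_mul_of_nonneg_right (by linarith) (abs_nonneg _)
        linarith
      -- `P` and `Q` are distinct free servers, so no truncation occurs in the count of common
      -- places: after this request `Q` is private to the first run and `P` to the second.
      · rw [mem_free] at hP hQ
        have h3 := hA.cost_foldl_le H hR hp (N.map Prod.snd) (M ++ [(e.1, P)])
          (M ++ [(p e.2, Q)])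
          (fun t => c t - load M t - (if t = P then 1 else 0) - if t = Q then 1 else 0) Q P
          (Ne.symm hPQ) (fun t => ?_) (fun t => ?_)
        · have r1 := hR _ _ _ (hP' Q (mem_free.2 hQ) (Ne.symm hPQ))
          have r2 := hR _ _ _ (hQ' P (mem_free.2 hP) hPQ)
          rw [hp e.2] at r2
          have h4 := H.potential_start hX hK hθ hθ' (univ.filter fun t => 0 < c t - load M t -
            (if t = P then 1 else 0) - if t = Q then 1 else 0) hPQ r1 r2
          rw [← hp, ← hp, ← hp] at h4
          rw [cost_snoc, cost_snoc] at h3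
          linarith
        all_goals
          have := hM t
          rw [load_snoc]
          by_cases ht : t = P
          · subst ht
            simp only [hPQ, if_true, if_false]
            omega
          · by_cases ht' : t = Q
            · subst ht'
              simp only [ht, if_true, if_false]
              omega
            · simp only [ht, ht', if_false]
              omega
    · rw [A.step_of_not_nonempty _ hn, A.step_of_not_nonempty _ hn]
      have h1 := ih M hM
      have h2 : 0 ≤ K * |e.1 - p e.2| := mul_nonneg (by linarith) (abs_nonneg _)
      linarith

theorem optCost_eq {m : ℕ} {p : Fin m → ℝ} {c : Fin m → ℕ} {σ : List ℝ} {M : Matching m}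
    (h : IsOptimalMatching p c σ M) : optCost p c σ = cost p M := by
  refine IsLeast.csInf_eq ⟨⟨M, h.1, rfl⟩, ?_⟩
  rintro _ ⟨N, hN, rfl⟩
  exact h.2 N hN

theorem exists_isOptimalMatching_of_admissible {m : ℕ} (p : Fin m → ℝ) (c : Fin m → ℕ)
    {σ : List ℝ} (h : Admissible c σ) : ∃ M, IsOptimalMatching p c σ M := by
  obtain ⟨_, Opt, hOpt, -⟩ := exists_isPermutationAlgorithm p c
  exact ⟨_, hOpt σ h⟩

theorem PicksBy.isCompetitive (hA : PicksBy A R) (H : TwoSided sd n θ X)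
    (hR : ∀ r s g, R r s g → Pref sd n θ r s g) {p : Fin m → ℝ} (hp : ∀ j, p j = sd j * n j)
    {K : ℝ} (hX : 2 * X ≤ K - 1)
    (hK : ∀ i j, sd i = sd j → n i < n j → 2 * (X - n i) ≤ (K - 1) * (n j - n i))
    (hθ : ∀ i j, sd i = sd j → n i < n j → (K + 1) * (θ i - n i) ≤ (K - 1) * (n j - n i))
    (hθ' : ∀ i j, sd i = sd j → n i < n j → 2 * (X - n i) ≤ (K + 1) * (θ i - n i)) :
    IsCompetitive p A K := by
  intro σ hσ
  obtain ⟨N, hN⟩ := exists_isOptimalMatching_of_admissible p c hσ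
  have h1 := hA.cost_foldl_le_of_matching H hR hp hX hK hθ hθ' N [] fun t => Nat.zero_le _
  rw [hA.cost_foldl_at_servers H hR hp N [] fun t => by
    rw [load_nil, zero_add]; exact hN.1.2 t, hN.1.1] at h1
  rw [optCost_eq hN]
  simpa [cost, OnlineAlgorithm.run] using h1

end Discrepancy

/-! ### PTCP -/

theorem Prefers.asymm {k : ℕ} {δ r : ℝ} {s g : Fin (2 * k)} (hsg : s ≠ g)
    (h : Prefers k δ r s g) : ¬ Prefers k δ r g s := by
  intro h'
  rcases lt_or_gt_of_ne hsg with hlt | hlt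
  · exact absurd (h.1 hlt) (not_le.2 (h'.2 hlt))
  · exact absurd (h'.1 hlt) (not_le.2 (h.2 hlt))

theorem ptcp_picksBy {k : ℕ} {δ : ℝ} (h0 : 0 < δ) (h1 : δ < 1) (c : Fin (2 * k) → ℕ) :
    PicksBy (ptcp (layout k δ) c) fun r s g => s ≠ g ∧ Prefers k δ r s g :=
  ⟨fun _ _ _ h h' => h.2.asymm h.1 h'.2, fun _ r h g hg hne =>
    ⟨Ne.symm hne, prefers_ptcpServer h0 h1 r _ h g hg hne⟩⟩

theorem side_eq_iff {k : ℕ} {i j : Fin (2 * k)} :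
    side k i = side k j ↔ ((i : ℕ) < k ↔ (j : ℕ) < k) := by
  unfold side
  split_ifs with h1 h2 h2 <;> norm_num [h1, h2]

theorem rank_pos {k : ℕ} (j : Fin (2 * k)) : 1 ≤ rank k j := by
  unfold rank
  split_ifs <;> omega

theorem rank_le {k : ℕ} (j : Fin (2 * k)) : rank k j ≤ k := by
  unfold rank
  split_ifs <;> omega

/-- The critical point behind a server, between the harmonic bounds that its definition gives. -/
theorem critical_bounds {δ K : ℝ} (h0 : 0 < δ) (h1 : δ < 1) (hK : 2 * (1 - δ)⁻¹ ≤ K - 1)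
    {k e : ℕ} (he : e < k) :
    radius δ e < critical k δ e ∧ critical k δ e < radius δ (e + 1) ∧
      2 * (radius δ k - radius δ e) ≤ (K - 1) * δ ^ e ∧
      (K + 1) * (critical k δ e - radius δ e) ≤ (K - 1) * δ ^ e ∧
      2 * (radius δ k - radius δ e) ≤ (K + 1) * (critical k δ e - radius δ e) := by
  have hD := pow_pos h0 e
  have hL := sub_pos.2 (radius_strictMono h0 h1 he)
  have hle := radius_sub_le h0 h1 k e
  have hinv : 0 < (1 - δ)⁻¹ := inv_pos.2 (by linarith)
  have h3 : 2 * (radius δ k - radius δ e) ≤ (K - 1) * δ ^ e := by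
    have := mul_le_mul_of_nonneg_left hK hD.le
    linarith
  rw [radius_succ h1]
  unfold critical
  generalize δ ^ e = D at *
  generalize radius δ k - radius δ e = L at *
  rw [add_sub_cancel_left]
  refine ⟨by linarith [div_pos (mul_pos hD hL) (add_pos hD hL)], ?_, h3, ?_, ?_⟩
  · rw [add_lt_add_iff_left, div_lt_iff₀ (by linarith)]
    nlinarith
  -- After multiplication by `D + L`, this bound and the next one both reduce to `h3`: the critical
  -- point balances them.
  · rw [← mul_div_assoc, div_le_iff₀ (by linarith)]
    nlinarith
  · rw [← mul_div_assoc, le_div_iff₀ (by linarith)]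
    nlinarith

theorem radius_lt_radius_iff {δ : ℝ} (h0 : 0 < δ) (h1 : δ < 1) {i j : ℕ} :
    radius δ i < radius δ j ↔ i < j := (radius_strictMono h0 h1).lt_iff_lt

theorem twoSided_layout {k : ℕ} {δ : ℝ} (h0 : 0 < δ) (h1 : δ < 1) :
    TwoSided (side k) (fun j => radius δ (rank k j)) (fun j => critical k δ (rank k j))
      (radius δ k) where
  sd_cases j := by
    unfold side
    split_ifs <;> simp
  one_le j := one_le_radius h0 h1 (rank_pos j)
  le_max j := (radius_strictMono h0 h1).monotone (rank_le j)
  lt_crit i j _ h := by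
    rw [radius_lt_radius_iff h0 h1] at h
    -- The bounds used here do not involve `K`; the smallest admissible value is inserted.
    exact (critical_bounds (K := 1 + 2 * (1 - δ)⁻¹) h0 h1 (by linarith)
      (h.trans_le (rank_le j))).1
  crit_lt i j _ h := by
    rw [radius_lt_radius_iff h0 h1] at h
    exact (critical_bounds (K := 1 + 2 * (1 - δ)⁻¹) h0 h1 (by linarith)
      (h.trans_le (rank_le j))).2.1.trans_le ((radius_strictMono h0 h1).monotone h)
  inj i j hs h := by
    have h' := (radius_strictMono h0 h1).injective h
    rw [side_eq_iff] at hs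
    unfold rank at h'
    refine Fin.ext ?_
    split_ifs at h' <;> omega

/-- PTCP sends ties to the left, so its two sides are not exact mirror images. The weak inequalities
of `Pref` forget this, and one argument serves both sides. -/
theorem Prefers.pref {k : ℕ} {δ r : ℝ} (h0 : 0 < δ) (h1 : δ < 1) {s g : Fin (2 * k)}
    (h : Prefers k δ r s g) : Pref (side k) (fun j => radius δ (rank k j))
      (fun j => critical k δ (rank k j)) r s g := by
  obtain ⟨ha, hb⟩ := h
  simp only [Fin.lt_def, threshold] at ha hb
  refine ⟨fun hs => ?_, fun hs hn => ?_, fun hs hn => ?_⟩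
  · rw [Ne, side_eq_iff] at hs
    unfold side
    split_ifs with h2
    · have h3 : ¬ (g : ℕ) < k := fun h => hs (iff_of_true h2 h)
      have := ha (by omega)
      rw [if_neg h3, if_neg (by omega)] at this
      linarith
    · have h3 : (g : ℕ) < k := by by_contra h; exact hs (iff_of_false h2 h)
      have := hb (by omega)
      rw [if_neg h2, if_neg (by omega)] at this
      linarith
  · rw [side_eq_iff] at hs
    replace hn := (radius_lt_radius_iff h0 h1).1 hn
    unfold side
    split_ifs with h2
    · have h3 := hs.1 h2
      have : (g : ℕ) < s := by simp only [rank, h2, h3, if_true] at hn; omega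
      have := hb this
      rw [if_pos h2] at this
      linarith
    · have h3 : ¬ (g : ℕ) < k := fun h => h2 (hs.2 h)
      have : (s : ℕ) < g := by simp only [rank, h2, h3, if_false] at hn; omega
      have := ha this
      rw [if_neg h3, if_pos (by omega)] at this
      linarith
  · rw [side_eq_iff] at hs
    replace hn := (radius_lt_radius_iff h0 h1).1 hn
    unfold side
    split_ifs with h2
    · have h3 := hs.1 h2
      have : (s : ℕ) < g := by simp only [rank, h2, h3, if_true] at hn; omega
      have := ha this
      rw [if_pos h3] at this
      linarith
    · have h3 : ¬ (g : ℕ) < k := fun h => h2 (hs.2 h)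
      have : (g : ℕ) < s := by simp only [rank, h2, h3, if_false] at hn; omega
      have := hb this
      rw [if_neg h2, if_pos (by omega)] at this
      linarith

theorem ptcp_isCompetitive {k : ℕ} {δ K : ℝ} (h0 : 0 < δ) (h1 : δ < 1)
    (hK : 2 * (1 - δ)⁻¹ ≤ K - 1) (c : Fin (2 * k) → ℕ) :
    IsCompetitive (layout k δ) (ptcp (layout k δ) c) K := by
  have hinv : 0 < (1 - δ)⁻¹ := inv_pos.2 (by linarith)
  -- No server behind `i` is closer to it than the adjacent one, so bounds in terms of the adjacent
  -- gap suffice.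
  have hgap : ∀ i j : Fin (2 * k), radius δ (rank k i) < radius δ (rank k j) →
      (K - 1) * δ ^ rank k i ≤ (K - 1) * (radius δ (rank k j) - radius δ (rank k i)) := by
    intro i j h
    rw [radius_lt_radius_iff h0 h1] at h
    have := (radius_strictMono h0 h1).monotone (Nat.succ_le_of_lt h)
    rw [Nat.succ_eq_add_one, radius_succ h1] at this
    exact mul_le_mul_of_nonneg_left (by linarith) (by linarith)
  have hb : ∀ i j : Fin (2 * k), radius δ (rank k i) < radius δ (rank k j) → rank k i < k :=
    fun i j h => ((radius_lt_radius_iff h0 h1).1 h).trans_le (rank_le j)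
  refine (ptcp_picksBy h0 h1 c).isCompetitive (twoSided_layout h0 h1)
    (fun r s g h => h.2.pref h0 h1) (layout_eq k δ) ?_ (fun i j _ h => ?_) (fun i j _ h => ?_)
    (fun i j _ h => ?_)
  · have := radius_sub_le h0 h1 k 0
    simp [radius] at this ⊢
    linarith
  · exact (critical_bounds h0 h1 hK (hb i j h)).2.2.1.trans (hgap i j h)
  · exact (critical_bounds h0 h1 hK (hb i j h)).2.2.2.1.trans (hgap i j h)
  · exact (critical_bounds h0 h1 hK (hb i j h)).2.2.2.2

/-! ### Sequences on which Permutation is forced -/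

theorem load_congr {m : ℕ} {M N : Matching m} (h : M.map Prod.snd = N.map Prod.snd) (t : Fin m) :
    load M t = load N t := by
  have key : ∀ M : Matching m, load M t = (M.map Prod.snd).countP (fun s => decide (s = t)) := by
    intro M
    rw [List.countP_map]
    rfl
  rw [key, key, h]

theorem load_pos_iff {m : ℕ} {M : Matching m} {t : Fin m} : 0 < load M t ↔ ∃ e ∈ M, e.2 = t := by
  simp [load, List.countP_pos_iff]

theorem sum_map_snd {m : ℕ} (g : Fin m → ℝ) (M : Matching m) :
    (M.map fun e => g e.2).sum = ∑ t, load M t * g t := by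
  induction M with
  | nil => simp [load_nil]
  | cons e M ih => simp [load_cons, ih, add_mul, sum_add_distrib, add_comm]

/-- A lower bound for the cost from a potential on the line, which depends only on the requests and
on the loads. -/
theorem sum_abs_sub_abs_le_cost {m : ℕ} (p : Fin m → ℝ) (z : ℝ) {M N : Matching m}
    (h : M.map Prod.fst = N.map Prod.fst) (hload : ∀ t, load M t = load N t) :
    (N.map fun e => |e.1 - z| - |p e.2 - z|).sum ≤ cost p M := by
  have key : ∀ M : Matching m, (M.map fun e => |e.1 - z| - |p e.2 - z|).sum =
      ((M.map Prod.fst).map fun r => |r - z|).sum - ∑ t, load M t * |p t - z| := by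
    intro M
    rw [← sum_map_snd (fun t => |p t - z|)]
    induction M with
    | nil => simp
    | cons e M ih =>
      simp only [List.map_cons, List.sum_cons, ih]
      ring
  have hMN : (N.map fun e => |e.1 - z| - |p e.2 - z|).sum =
      (M.map fun e => |e.1 - z| - |p e.2 - z|).sum := by
    rw [key, key, h]
    simp only [hload]
  rw [hMN, cost]
  refine List.sum_le_sum fun e _ => ?_
  have := abs_sub_abs_le_abs_sub (e.1 - z) (p e.2 - z)
  rwa [sub_sub_sub_cancel_right] at this

/-- There are requests at the servers with prescribed multiplicities. -/
theorem exists_matching_at_servers {m : ℕ} (p : Fin m → ℝ) (f : Fin m → ℕ) :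
    ∃ N : Matching m, (∀ t, load N t = f t) ∧ ∀ e ∈ N, e.1 = p e.2 := by
  have key : ∀ T : Finset (Fin m), ∃ N : Matching m,
      (∀ t, load N t = if t ∈ T then f t else 0) ∧ ∀ e ∈ N, e.1 = p e.2 := by
    intro T
    induction T using Finset.induction_on with
    | empty => exact ⟨[], by simp [load_nil], by simp⟩
    | insert s T hs ih =>
      obtain ⟨N, h1, h2⟩ := ih
      refine ⟨N ++ List.replicate (f s) (p s, s), fun t => ?_, fun e he => ?_⟩
      · rw [load_append, h1, load, List.countP_replicate]
        by_cases ht : t = s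
        · subst ht
          simp [hs]
        · simp [ht, Ne.symm ht]
      · rcases List.mem_append.1 he with h | h
        · exact h2 e h
        · rw [List.eq_of_mem_replicate h]
  simpa using key univ

theorem cost_nonneg {m : ℕ} (p : Fin m → ℝ) (M : Matching m) : 0 ≤ cost p M := by
  refine List.sum_nonneg fun x hx => ?_
  obtain ⟨e, -, rfl⟩ := List.mem_map.1 hx
  exact abs_nonneg _

theorem cost_eq_zero_iff {m : ℕ} (p : Fin m → ℝ) (M : Matching m) :
    cost p M = 0 ↔ ∀ e ∈ M, e.1 = p e.2 := by
  induction M with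
  | nil => simp [cost]
  | cons e M ih =>
    rw [cost_cons, add_eq_zero_iff_of_nonneg (abs_nonneg _) (cost_nonneg p M), ih,
      List.forall_mem_cons, abs_eq_zero, sub_eq_zero]

/-- At cost zero each request names its server. This determines the optimal matching of the prefix
of the chase. -/
theorem eq_of_at_servers {m : ℕ} {p : Fin m → ℝ} (hp : Function.Injective p) {M : Matching m} :
    ∀ {N : Matching m}, M.map Prod.fst = N.map Prod.fst → (∀ e ∈ M, e.1 = p e.2) →
      (∀ e ∈ N, e.1 = p e.2) → M = N := by
  induction M with
  | nil =>
    intro N h _ _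
    simpa using h
  | cons e M ih =>
    intro N h hM hN
    cases N with
    | nil => simp at h
    | cons e' N =>
      simp only [List.map_cons, List.cons.injEq, List.forall_mem_cons] at h hM hN
      rw [ih h.2 hM.2 hN.2, Prod.ext h.1 (hp (hM.1 ▸ hN.1 ▸ h.1))]

theorem IsMatching.admissible {m : ℕ} {c : Fin m → ℕ} {σ : List ℝ} {M : Matching m}
    (h : IsMatching c σ M) : Admissible c σ := by
  rw [Admissible, ← h.1, List.length_map, ← sum_load]
  exact sum_le_sum fun s _ => h.2 s

/-- The requests `η, p (e 0), p (e 1), …`. -/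
def chase {m : ℕ} (p : Fin m → ℝ) (η : ℝ) (e : ℕ → Fin m) : ℕ → ℝ
  | 0 => η
  | j + 1 => p (e j)

theorem chase_succ {m : ℕ} (p : Fin m → ℝ) (η : ℝ) (e : ℕ → Fin m) (j : ℕ) :
    chase p η e (j + 1) = p (e j) := rfl

/-- The matching of the first `j` requests of `chase` in which the server runs ahead by one. -/
def chaseMatching {m : ℕ} (p : Fin m → ℝ) (η : ℝ) (e : ℕ → Fin m) (j : ℕ) : Matching m :=
  (List.range j).map fun i => (chase p η e i, e i)

section Chase

variable {m : ℕ} {p : Fin m → ℝ} {c : Fin m → ℕ} {η : ℝ} {e : ℕ → Fin m}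

theorem chaseMatching_succ (j : ℕ) :
    chaseMatching p η e (j + 1) = chaseMatching p η e j ++ [(chase p η e j, e j)] := by
  simp [chaseMatching, List.range_succ]

theorem load_chaseMatching_pos {i j : ℕ} (h : i < j) :
    0 < load (chaseMatching p η e j) (e i) :=
  load_pos_iff.2 ⟨_, List.mem_map.2 ⟨i, List.mem_range.2 h, rfl⟩, rfl⟩

theorem load_chaseMatching_le_one (hinj : ∀ i j, i < j → j < m → e i ≠ e j) (j : ℕ) (hj : j ≤ m)
    (t : Fin m) : load (chaseMatching p η e j) t ≤ 1 := by
  induction j with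
  | zero => simp [chaseMatching, load_nil]
  | succ j ih =>
    rw [chaseMatching_succ, load_snoc]
    split_ifs with h
    · have : ¬ 0 < load (chaseMatching p η e j) t := fun hpos => by
        obtain ⟨x, hx, hxt⟩ := load_pos_iff.1 hpos
        obtain ⟨i, hi, rfl⟩ := List.mem_map.1 hx
        exact hinj i j (List.mem_range.1 hi) (by omega) (hxt.trans h)
      omega
    · exact ih (by omega)

/-- A cheap matching with the same loads: the extra request is served by the last server, along
the servers of its side. -/
theorem exists_cheap_matching (N : Matching m) (hN : ∀ x ∈ N, x.1 = p x.2)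
    (hside : ∀ j, j + 2 < m →
      |η - p (e j)| + |p (e j) - p (e (j + 2))| ≤ |η - p (e (j + 2))|) : ∀ j, j ≤ m →
    ∃ M : Matching m, M.map Prod.fst = (N ++ chaseMatching p η e j).map Prod.fst ∧
      (∀ t, load M t = load (N ++ chaseMatching p η e j) t) ∧ cost p M ≤ |η - chase p η e j|
  | 0, _ => ⟨N, by simp [chaseMatching], by simp [chaseMatching],
      by rw [(cost_eq_zero_iff p N).2 hN]; exact abs_nonneg _⟩
  | 1, _ => ⟨N ++ [(η, e 0)], by simp [chaseMatching, chase],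
      by simp [chaseMatching, chase], by
        rw [cost_snoc, (cost_eq_zero_iff p N).2 hN, zero_add]
        exact le_rfl⟩
  | j + 2, hj => by
    obtain ⟨M, h1, h2, h3⟩ := exists_cheap_matching N hN hside j (by omega)
    -- The request at `e j` stays at its own server for free; the one before it goes on to `e (j +
    -- 1)`, in line with `η`, so the distances add up.
    refine ⟨M ++ [(chase p η e j, e (j + 1)), (chase p η e (j + 1), e j)], ?_, fun t => ?_, ?_⟩
    · rw [chaseMatching_succ, chaseMatching_succ, List.map_append, h1]
      simp
    · rw [chaseMatching_succ, chaseMatching_succ, load_append, h2]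
      simp only [load_append, load_cons, load_nil]
      ring
    · have h4 : |η - chase p η e j| + |chase p η e j - p (e (j + 1))| ≤ |η - p (e (j + 1))| := by
        cases j with
        | zero => simp [chase]
        | succ j => exact hside j (by omega)
      rw [cost_append, cost_cons, cost_cons]
      simp only [chase_succ, sub_self, abs_zero, cost, List.map_nil, List.sum_nil]
      rw [cost] at h3
      linarith

/-- The requests `η, p (e 0), p (e 1), …`, after a prefix that leaves a single place at every
server, force Permutation to use the servers `e 0, e 1, …`, provided that these are sorted by their
distances from `η`. -/
theorem IsPermutationAlgorithm.exists_chase (hp : Function.Injective p) (hc : ∀ s, 1 ≤ c s)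
    {P : OnlineAlgorithm c} (hP : IsPermutationAlgorithm p P) (hsurj : ∀ s, ∃ i < m, e i = s)
    (hdist : ∀ i j, i < j → j < m → |η - p (e i)| < |η - p (e j)|)
    (hside : ∀ j, j + 2 < m →
      |η - p (e j)| + |p (e j) - p (e (j + 2))| ≤ |η - p (e (j + 2))|) :
    ∃ σ, Admissible c σ ∧ optCost p c σ ≤ |η - chase p η e m| ∧
      cost p (chaseMatching p η e m) ≤ cost p (P.run σ) := by
  obtain ⟨Opt, hOpt, hstep⟩ := hP
  obtain ⟨N, hN1, hN2⟩ := exists_matching_at_servers p fun s => c s - 1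
  have hinj : ∀ i j, i < j → j < m → e i ≠ e j := fun i j hij hj h =>
    (hdist i j hij hj).ne (by rw [h])
  let σ : ℕ → List ℝ := fun j => (N ++ chaseMatching p η e j).map Prod.fst
  have hσ : ∀ j, σ (j + 1) = σ j ++ [chase p η e j] := fun j => by
    simp [σ, chaseMatching_succ]
  have hmatch : ∀ j ≤ m, ∃ M, IsMatching c (σ j) M ∧ cost p M ≤ |η - chase p η e j| := by
    intro j hj
    obtain ⟨M, h1, h2, h3⟩ := exists_cheap_matching N hN2 hside j hj
    refine ⟨M, ⟨h1, fun t => ?_⟩, h3⟩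
    have := load_chaseMatching_le_one (p := p) (η := η) hinj j hj t
    have := hc t
    rw [h2, load_append, hN1]
    omega
  have hadm : ∀ j ≤ m, Admissible c (σ j) := fun j hj => by
    obtain ⟨M, hM, -⟩ := hmatch j hj
    exact hM.admissible
  have hcost : ∀ j ≤ m, cost p (Opt (σ j)) ≤ |η - chase p η e j| := fun j hj => by
    obtain ⟨M, hM, hle⟩ := hmatch j hj
    exact ((hOpt _ (hadm j hj)).2 M hM).trans hle
  have hmain : ∀ j ≤ m, (∀ t, load (Opt (σ j)) t = load (N ++ chaseMatching p η e j) t) ∧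
      P.run (σ j) = P.run (σ 0) ++ chaseMatching p η e j := by
    intro j
    induction j with
    | zero =>
      intro hj
      have h0 := hOpt _ (hadm 0 hj)
      have h1 : cost p (Opt (σ 0)) = 0 := by
        have := hcost 0 hj
        rw [chase, sub_self, abs_zero] at this
        exact le_antisymm this (cost_nonneg p _)
      have h2 := eq_of_at_servers hp (M := Opt (σ 0)) (N := N)
        (by rw [h0.1.1]; simp [σ, chaseMatching]) ((cost_eq_zero_iff p _).1 h1) hN2
      rw [h2]
      simp [chaseMatching]
    | succ j ih =>
      intro hj
      obtain ⟨ih1, ih2⟩ := ih (by omega)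
      have ha := hadm (j + 1) hj
      have ho := hOpt _ ha
      have hcj := hcost (j + 1) hj
      rw [hσ] at ha ho hcj
      obtain ⟨s, hs1, hs2⟩ := hstep _ _ ha
      have hs : s = e j := by
        obtain ⟨i, hi, rfl⟩ := hsurj s
        -- For `i < j` the only place left at `e i` by the prefix is already in use.
        have hji : j ≤ i := by
          by_contra hij
          have h1 := ho.1.2 (e i)
          have h2 := load_chaseMatching_pos (p := p) (η := η) (e := e) (not_le.1 hij)
          have h3 := hc (e i)
          rw [hs1, ih1, load_append, hN1, if_pos rfl] at h1
          omega
        by_contra hne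
        have hlt : j < i := lt_of_le_of_ne hji fun h => hne (by rw [h])
        have h1 := hdist j i hlt hi
        -- The comparison matching has the loads that the choice of `e i` would produce: `η` goes to
        -- `e i`, and all else is free. The potential centred at `e i` then forces a cost of at
        -- least `|η - p (e i)|`, contradicting `hcj`.
        have h2 := sum_abs_sub_abs_le_cost p (p (e i)) (M := Opt (σ j ++ [chase p η e j]))
          (N := N ++ (η, e i) :: (List.range j).map fun l => (p (e l), e l)) ?_ ?_
        · have h3 : (N.map fun x => |x.1 - p (e i)| - |p x.2 - p (e i)|).sum = 0 := by
            refine List.sum_eq_zero fun y hy => ?_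
            obtain ⟨x, hx, rfl⟩ := List.mem_map.1 hy
            simp only [hN2 x hx, sub_self]
          have h4 : (((List.range j).map fun l => (p (e l), e l)).map
              fun x => |x.1 - p (e i)| - |p x.2 - p (e i)|).sum = 0 := by
            refine List.sum_eq_zero fun y hy => ?_
            simp only [List.map_map, List.mem_map, Function.comp_apply, sub_self] at hy
            obtain ⟨_, _, rfl⟩ := hy
            rfl
          rw [List.map_append, List.sum_append, List.map_cons, List.sum_cons, h3, h4, sub_self,
            abs_zero] at h2
          rw [chase_succ] at hcj
          linarith
        · rw [ho.1.1, ← hσ]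
          simp [σ, chaseMatching, List.range_succ_eq_map, chase]
        · intro t
          have h3 : load (chaseMatching p η e j) t =
              load ((List.range j).map fun l => (p (e l), e l)) t :=
            load_congr (by simp [chaseMatching]) t
          rw [hs1, ih1, load_append, load_append, load_cons, h3]
          ring
      rw [hσ, chaseMatching_succ]
      refine ⟨fun t => ?_, ?_⟩
      · rw [hs1, ih1, ← List.append_assoc, load_snoc, hs]
      · rw [hs2, ih2, hs, List.append_assoc]
  refine ⟨σ m, hadm m le_rfl, ?_, ?_⟩
  · rw [optCost_eq (hOpt _ (hadm m le_rfl))]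
    exact hcost m le_rfl
  · rw [(hmain m le_rfl).2, cost_append]
    linarith [cost_nonneg p (P.run (σ 0))]

end Chase

/-! ### The lower bound for Permutation on the layout -/

/-- The servers from the inside to the outside, alternating between the sides. -/
def zigzag (k : ℕ) (hk : 1 ≤ k) (i : ℕ) : Fin (2 * k) :=
  -- The remainder modulo `2 * k` only makes the function total; it changes nothing for `i < 2 * k`.
  ⟨(if i % 2 = 0 then k + i / 2 else k - 1 - i / 2) % (2 * k), Nat.mod_lt _ (by omega)⟩

theorem layout_zigzag_even {k : ℕ} (hk : 1 ≤ k) (δ : ℝ) {a : ℕ} (ha : a < k) :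
    layout k δ (zigzag k hk (2 * a)) = radius δ (a + 1) := by
  have h : ((zigzag k hk (2 * a) : Fin (2 * k)) : ℕ) = k + a := by
    simp only [zigzag, Nat.mul_mod_right, if_true]
    rw [Nat.mod_eq_of_lt (by omega)]
    omega
  rw [layout_right (by omega), h]
  congr 1
  omega

theorem layout_zigzag_odd {k : ℕ} (hk : 1 ≤ k) (δ : ℝ) {a : ℕ} (ha : a < k) :
    layout k δ (zigzag k hk (2 * a + 1)) = -radius δ (a + 1) := by
  have h : ((zigzag k hk (2 * a + 1) : Fin (2 * k)) : ℕ) = k - 1 - a := by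
    simp only [zigzag]
    rw [if_neg (by omega), Nat.mod_eq_of_lt (by omega)]
    omega
  rw [layout_left (by omega), h]
  congr 2
  omega

theorem zigzag_surj {k : ℕ} (hk : 1 ≤ k) (s : Fin (2 * k)) : ∃ i < 2 * k, zigzag k hk i = s := by
  have := s.2
  rcases lt_or_ge (s : ℕ) k with h | h
  · refine ⟨2 * (k - 1 - s) + 1, by omega, Fin.ext ?_⟩
    simp only [zigzag]
    rw [if_neg (by omega), Nat.mod_eq_of_lt (by omega)]
    omega
  · refine ⟨2 * (s - k), by omega, Fin.ext ?_⟩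
    simp only [zigzag]
    rw [if_pos (by omega), Nat.mod_eq_of_lt (by omega)]
    omega

theorem abs_sub_zigzag_even {k : ℕ} (hk : 1 ≤ k) {δ η : ℝ} (h0 : 0 < δ) (h1 : δ < 1)
    (hη1 : η < 1) {a : ℕ} (ha : a < k) :
    |η - layout k δ (zigzag k hk (2 * a))| = radius δ (a + 1) - η := by
  have := one_le_radius h0 h1 (e := a + 1) (by omega)
  rw [layout_zigzag_even hk δ ha, abs_of_nonpos (by linarith)]
  ring

theorem abs_sub_zigzag_odd {k : ℕ} (hk : 1 ≤ k) {δ η : ℝ} (h0 : 0 < δ) (h1 : δ < 1)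
    (hη : 0 < η) {a : ℕ} (ha : a < k) :
    |η - layout k δ (zigzag k hk (2 * a + 1))| = radius δ (a + 1) + η := by
  have := one_le_radius h0 h1 (e := a + 1) (by omega)
  rw [layout_zigzag_odd hk δ ha, abs_of_nonneg (by linarith)]
  ring

/-- In each symmetric pair the right server is nearer to `η`, by `2 * η`; the gaps between the pairs
are at least `δ ^ k`, so the pairs do not interleave. -/
theorem abs_sub_zigzag_lt {k : ℕ} (hk : 1 ≤ k) {δ η : ℝ} (h0 : 0 < δ) (h1 : δ < 1) (hη : 0 < η)
    (hη1 : η < 1) (hηδ : 2 * η < δ ^ k) {i j : ℕ} (hij : i < j) (hj : j < 2 * k) :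
    |η - layout k δ (zigzag k hk i)| < |η - layout k δ (zigzag k hk j)| := by
  have hgap : ∀ a b, a < b → b < k → radius δ (a + 1) + η < radius δ (b + 1) - η := by
    intro a b hab hb
    have h2 := (radius_strictMono h0 h1).monotone (show a + 1 + 1 ≤ b + 1 by omega)
    have h3 := pow_le_pow_of_le_one h0.le h1.le (show a + 1 ≤ k by omega)
    rw [radius_succ h1 (a + 1)] at h2
    linarith
  obtain ⟨a, rfl | rfl⟩ := i.even_or_odd' <;> obtain ⟨b, rfl | rfl⟩ := j.even_or_odd'
  · rw [abs_sub_zigzag_even hk h0 h1 hη1 (by omega), abs_sub_zigzag_even hk h0 h1 hη1 (by omega)]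
    linarith [hgap a b (by omega) (by omega)]
  · rw [abs_sub_zigzag_even hk h0 h1 hη1 (by omega), abs_sub_zigzag_odd hk h0 h1 hη (by omega)]
    rcases (show a ≤ b by omega).eq_or_lt with rfl | h
    · linarith
    · linarith [hgap a b h (by omega)]
  · rw [abs_sub_zigzag_odd hk h0 h1 hη (by omega), abs_sub_zigzag_even hk h0 h1 hη1 (by omega)]
    linarith [hgap a b (by omega) (by omega)]
  · rw [abs_sub_zigzag_odd hk h0 h1 hη (by omega), abs_sub_zigzag_odd hk h0 h1 hη (by omega)]
    linarith [hgap a b (by omega) (by omega)]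

theorem abs_sub_zigzag_add {k : ℕ} (hk : 1 ≤ k) {δ η : ℝ} (h0 : 0 < δ) (h1 : δ < 1) (hη : 0 < η)
    (hη1 : η < 1) {j : ℕ} (hj : j + 2 < 2 * k) :
    |η - layout k δ (zigzag k hk j)| +
      |layout k δ (zigzag k hk j) - layout k δ (zigzag k hk (j + 2))| ≤
      |η - layout k δ (zigzag k hk (j + 2))| := by
  obtain ⟨a, rfl | rfl⟩ := j.even_or_odd'
  · rw [show 2 * a + 2 = 2 * (a + 1) by ring, abs_sub_zigzag_even hk h0 h1 hη1 (by omega),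
      abs_sub_zigzag_even hk h0 h1 hη1 (by omega), layout_zigzag_even hk δ (by omega),
      layout_zigzag_even hk δ (by omega)]
    have := radius_strictMono h0 h1 (Nat.lt_succ_self (a + 1))
    rw [abs_of_neg (by simp only [Nat.succ_eq_add_one] at this; linarith)]
    linarith
  · rw [show 2 * a + 1 + 2 = 2 * (a + 1) + 1 by ring, abs_sub_zigzag_odd hk h0 h1 hη (by omega),
      abs_sub_zigzag_odd hk h0 h1 hη (by omega), layout_zigzag_odd hk δ (by omega),
      layout_zigzag_odd hk δ (by omega)]
    have := radius_strictMono h0 h1 (Nat.lt_succ_self (a + 1))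
    rw [abs_of_pos (by simp only [Nat.succ_eq_add_one] at this; linarith)]
    linarith

/-- Every match after the first crosses the central gap, of length 2. -/
theorem le_cost_chaseMatching_zigzag {k : ℕ} (hk : 1 ≤ k) {δ η : ℝ} (h0 : 0 < δ) (h1 : δ < 1)
    (hη1 : η < 1) (j : ℕ) (hj : j < 2 * k) :
    1 - η + 2 * j ≤
      cost (layout k δ) (chaseMatching (layout k δ) η (zigzag k hk) (j + 1)) := by
  induction j with
  | zero =>
    rw [chaseMatching_succ, cost_snoc, chase]
    have := abs_sub_zigzag_even hk h0 h1 hη1 (a := 0) (by omega)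
    rw [mul_zero] at this
    rw [this, zero_add, radius_one h1]
    simp [chaseMatching, cost]
  | succ j ih =>
    have h2 := ih (by omega)
    rw [chaseMatching_succ, cost_snoc, chase]
    suffices h3 : 2 ≤ |layout k δ (zigzag k hk j) - layout k δ (zigzag k hk (j + 1))| by
      push_cast
      linarith
    obtain ⟨a, rfl | rfl⟩ := j.even_or_odd'
    · rw [layout_zigzag_even hk δ (by omega), layout_zigzag_odd hk δ (by omega)]
      have := one_le_radius h0 h1 (e := a + 1) (by omega)
      exact (by linarith : (2 : ℝ) ≤ _ - -_).trans (le_abs_self _)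
    · rw [show 2 * a + 1 + 1 = 2 * (a + 1) by ring, layout_zigzag_even hk δ (by omega),
        layout_zigzag_odd hk δ (by omega)]
      have := one_le_radius h0 h1 (e := a + 1) (by omega)
      have := one_le_radius h0 h1 (e := a + 1 + 1) (by omega)
      rw [abs_of_nonpos (by linarith)]
      linarith

theorem le_competitiveRatio_of_isPermutationAlgorithm {k : ℕ} (hk : 1 ≤ k) {δ ε : ℝ} (h0 : 0 < δ)
    (h1 : δ < 1) (hδ : δ ^ k + δ * (4 * (k : ℝ) - 1) < ε) {c : Fin (2 * k) → ℕ}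
    (hc : ∀ s, 1 ≤ c s) {P : OnlineAlgorithm c} (hP : IsPermutationAlgorithm (layout k δ) P) :
    ((4 * (k : ℝ) - 1 - ε : ℝ) : EReal) ≤ competitiveRatio (layout k δ) P := by
  refine le_sInf ?_
  rintro _ ⟨ρ, ⟨hρ1, hρ⟩, rfl⟩
  rw [EReal.coe_le_coe_iff]
  have hk' : (1 : ℝ) ≤ k := by exact_mod_cast hk
  have hpow := pow_pos h0 k
  have hpow1 : δ ^ k < 1 := pow_lt_one₀ h0.le h1 (by omega)
  -- The error term `4 * k * η` of the final estimate is then exactly the summand `δ ^ k` of `hδ`.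
  set η : ℝ := δ ^ k / (4 * k) with hηdef
  have hηk : η * (4 * k) = δ ^ k := div_mul_cancel₀ _ (by positivity)
  have hη : 0 < η := by positivity
  have hηδ : 2 * η < δ ^ k := by nlinarith
  obtain ⟨σ, hσ, hopt, hcost⟩ := hP.exists_chase (η := η) (layout_strictMono h0 h1).injective hc
    (zigzag_surj hk) (fun i j hij hj => abs_sub_zigzag_lt hk h0 h1 hη (by linarith) hηδ hij hj)
    fun j hj => abs_sub_zigzag_add hk h0 h1 hη (by linarith) hj
  have hlow := le_cost_chaseMatching_zigzag hk h0 h1 (η := η) (by linarith) (2 * k - 1) (by omega)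
  rw [show 2 * k - 1 + 1 = 2 * k by omega, Nat.cast_sub (by omega)] at hlow
  push_cast at hlow
  obtain ⟨a, rfl⟩ : ∃ a, k = a + 1 := ⟨k - 1, by omega⟩
  -- The last request is at `zigzag (2 * k - 2 + 1)`, the leftmost server, at distance `X + η` from
  -- `η`.
  replace hopt : optCost (layout (a + 1) δ) c σ ≤
      |η - layout (a + 1) δ (zigzag (a + 1) hk (2 * a + 1))| := hopt
  have hoptval := abs_sub_zigzag_odd hk h0 h1 hη (Nat.lt_succ_self a)
  have hratio := hρ σ hσ
  set X := radius δ (a + 1) with hX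
  have hX1 : 1 ≤ X := one_le_radius h0 h1 (by omega)
  have hXa : X - 1 ≤ δ * X := by
    have h2 : (1 - δ) * X = 1 - δ ^ (a + 1) := by
      rw [hX, radius]
      field_simp [show (1 : ℝ) - δ ≠ 0 by linarith]
    linarith
  -- With `k = a + 1`, the costs would give `ε * (X + η) < (4 * k - 1) * (X - 1) + 4 * k * η`, but
  -- the right side is at most `(δ * (4 * k - 1) + δ ^ k) * X ≤ ε * X`.
  by_contra hlt
  rw [not_le] at hlt
  push_cast at *
  have h3 : ρ * optCost (layout (a + 1) δ) c σ ≤ ρ * (X + η) :=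
    mul_le_mul_of_nonneg_left (hoptval ▸ hopt) (by linarith)
  have h4 : ρ * (X + η) < (4 * ((a : ℝ) + 1) - 1 - ε) * (X + η) :=
    mul_lt_mul_of_pos_right hlt (by linarith)
  have h5 : (4 * ((a : ℝ) + 1) - 1) * (X - 1) ≤ (4 * ((a : ℝ) + 1) - 1) * (δ * X) :=
    mul_le_mul_of_nonneg_left hXa (by linarith)
  have h6 : (δ ^ (a + 1) + δ * (4 * ((a : ℝ) + 1) - 1)) * X ≤ ε * X :=
    mul_le_mul_of_nonneg_right hδ.le (by linarith)
  have h7 : δ ^ (a + 1) * 1 ≤ δ ^ (a + 1) * X := mul_le_mul_of_nonneg_left hX1 hpow.le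
  have h8 : 0 < ε * η := mul_pos (by nlinarith) hη
  nlinarith

/-! ### The choice of `δ` and the theorem. -/

theorem exists_layout_parameter (k : ℕ) (hk : 1 ≤ k) (ε : ℝ) (hε : 0 < ε) :
    ∃ δ : ℝ, 0 < δ ∧ δ < 1 ∧ δ ^ k + δ * (4 * (k : ℝ) - 1) < ε ∧ (1 - δ)⁻¹ < 1 + ε / 2 := by
  have hk' : (1 : ℝ) ≤ k := by exact_mod_cast hk
  -- `δ < ε / (4 * k)` settles the first condition because `δ ^ k ≤ δ`; the second follows from `δ <
  -- ε / 4` and `δ < 1 / 2`.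
  obtain ⟨δ, h0, h1⟩ := exists_between (show (0 : ℝ) < min (1 / 2) (ε / (4 * k)) by positivity)
  obtain ⟨h2, h3⟩ := lt_min_iff.1 h1
  rw [lt_div_iff₀ (by positivity)] at h3
  have h4 : δ ^ k ≤ δ := pow_le_of_le_one h0.le (by linarith) (by omega)
  refine ⟨δ, h0, by linarith, by linarith, ?_⟩
  rw [inv_lt_iff_one_lt_mul₀ (by linarith)]
  nlinarith

end OFAL

theorem mainTheorem4 (k : ℕ) (hk : 1 ≤ k) (ε : ℝ) (hε : 0 < ε) :
    (∃ δ : ℝ, 0 < δ ∧ δ < 1 ∧ δ ^ k + δ * (4 * (k : ℝ) - 1) < ε ∧ (1 - δ)⁻¹ < 1 + ε / 2) ∧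
    ∀ δ : ℝ, 0 < δ → δ < 1 → δ ^ k + δ * (4 * (k : ℝ) - 1) < ε → (1 - δ)⁻¹ < 1 + ε / 2 →
      ∀ c : Fin (2 * k) → ℕ, (∀ s, 1 ≤ c s) →
        OFAL.IsCompetitive (OFAL.layout k δ) (OFAL.ptcp (OFAL.layout k δ) c) (3 + ε) ∧
        ∀ P : OFAL.OnlineAlgorithm c, OFAL.IsPermutationAlgorithm (OFAL.layout k δ) P →
          ((4 * (k : ℝ) - 1 - ε : ℝ) : EReal) ≤
            OFAL.competitiveRatio (OFAL.layout k δ) P :=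
  ⟨OFAL.exists_layout_parameter k hk ε hε, fun _ h0 h1 h2 h3 c hc =>
    ⟨OFAL.ptcp_isCompetitive h0 h1 (by linarith) c, fun _ hP =>
      OFAL.le_competitiveRatio_of_isPermutationAlgorithm hk h0 h1 h2 hc hP⟩⟩
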